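/- Let $l\ge 2$, let $\mathbb N=\{0,1,2,\dots\}$, and write $|u|=u_1+\dots+u_l$ for $u\in\mathbb N^l$. Let $p_1,\dots,p_l$ be probability mass functions on $\mathbb N^l$ such that, for every $j$, $p_j(\mathbf 0)=0$, $\sum_{k=1}^l p_j(\mathbf e_k)<1$ (where $\mathbf e_1,\dots,\mathbf e_l$ is the canonical basis), and $\sum_{u}|u|^2p_j(u)<\infty$. Let $M$ be the $l\times l$ matrix $M_{ik}=\sum_u u_k\,p_i(u)$. Assume that some power of $M$ has only positive entries and that the largest eigenvalue $\rho$ of $M$ satisfies $\rho>1$. Let $b$ be the left eigenvector, $b^{T}M=\rho\, b^{T}$, with nonnegative entries and $\sum_i b_i=1$. Let $Y^{(j)}_{n,i}$ ($n\ge 0$, $1\le j\le l$, $i\ge 1$) be independent random vectors, $Y^{(j)}_{n,i}$ having law $p_j$, and let $Z_0=\mathbf e_{i_0}$ for some fixed $i_0$ and $$Z_{n}=\sum_{j=1}^l\sum_{i=1}^{Z_{n-1,j}}Y^{(j)}_{n-1,i}\qquad(n\ge 1)$$ be the multitype branching process in which the $i$-th individual of type $j$ of generation $n-1$ has the vector $Y^{(j)}_{n-1,i}$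 of numbers of children of each type. Fix $r\ge 1$. For each $n\ge 1$ let $r$ individuals of generation $n$ be drawn uniformly at random without replacement, given the family tree up to generation $n$ (arbitrarily on the event $|Z_n|<r$), and let $X_{n,w}$ be the family-size vector reported by the $w$-th sampled individual, that is, the offspring vector $Y^{(j)}_{n-1,i}$ of its parent. Then, for all $u_1,\dots,u_r\in\mathbb N^l$, $$\lim_{n\to\infty}\mathbb P\bigl(X_{n,1}=u_1,\dots,X_{n,r}=u_r\bigr)=\prod_{w=1}^r p_S(u_w),\qquad p_S(u)=\frac{|u|}{\rho}\sum_{i=1}^l b_i\,p_i(u).$$ -/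

import Mathlib

open MeasureTheory ProbabilityTheory Filter Topology
open scoped ENNReal Matrix

namespace MultitypeGW

/-- The total number `|u| = u_1 + ⋯ + u_l` of individuals in a family-size vector `u`. -/
def size {l : ℕ} (u : Fin l → ℕ) : ℕ := ∑ k, u k

/-- The reproduction matrix: `M i k` is the mean number of type `k` children of a type `i` parent. -/
noncomputable def meanMatrix {l : ℕ} (p : Fin l → PMF (Fin l → ℕ)) : Matrix (Fin l) (Fin l) ℝ :=
  Matrix.of fun i k => ∑' u : Fin l → ℕ, (p i u).toReal * (u k : ℝ)

/-- The mixture `p_S(u) = (|u| / ρ) ∑ᵢ bᵢ pᵢ(u)`. -/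
noncomputable def sizeBiased {l : ℕ} (p : Fin l → PMF (Fin l → ℕ)) (b : Fin l → ℝ) (ρ : ℝ)
    (u : Fin l → ℕ) : ℝ :=
  (size u : ℝ) / ρ * ∑ i, b i * (p i u).toReal

section BranchingModel

variable {Ω : Type*} {l : ℕ}

/-- The population vectors, started from one individual of type `i₀`. Here `Y n j i` is the offspring
vector of the `i`-th individual (counting from `0`) of type `j` in generation `n`. -/
def population (Y : ℕ → Fin l → ℕ → Ω → (Fin l → ℕ)) (i₀ : Fin l) : ℕ → Ω → (Fin l → ℕ)
  | 0, _ => Pi.single i₀ 1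
  | n + 1, ω => ∑ j, ∑ i ∈ Finset.range (population Y i₀ n ω j), Y n j i ω

/-- Labels of the individuals of a generation `n + 1`: the label `((j, i), (k, c))` stands for the
`c`-th child of type `k` of the `i`-th individual of type `j` in generation `n`. -/
abbrev Individual (l : ℕ) : Type := (Fin l × ℕ) × (Fin l × ℕ)

/-- The (finite, random) set of the individuals of generation `n + 1`; it has
`size (population Y i₀ (n + 1) ω)` elements. -/
def individuals (Y : ℕ → Fin l → ℕ → Ω → (Fin l → ℕ)) (i₀ : Fin l) (n : ℕ) (ω : Ω) :
    Set (Individual l) :=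
  {a | a.1.2 < population Y i₀ n ω a.1.1 ∧ a.2.2 < Y n a.1.1 a.1.2 ω a.2.1}

/-- The σ-algebra generated by the offspring vectors of generations `0, …, n`, which determine the
family tree up to generation `n + 1`. -/
@[reducible]
def history (Y : ℕ → Fin l → ℕ → Ω → (Fin l → ℕ)) (n : ℕ) : MeasurableSpace Ω :=
  ⨆ (m : ℕ) (_ : m ≤ n) (j : Fin l) (i : ℕ), MeasurableSpace.comap (Y m j i) inferInstance

/-- The offspring vectors are independent, and those of the individuals of type `j` have law `p j`. -/
structure IsOffspring [MeasurableSpace Ω] (P : Measure Ω) (p : Fin l → PMF (Fin l → ℕ))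
    (Y : ℕ → Fin l → ℕ → Ω → (Fin l → ℕ)) : Prop where
  measurable : ∀ n j i, Measurable (Y n j i)
  law : ∀ n j i, P.map (Y n j i) = (p j).toMeasure
  indep : iIndepFun (fun a : ℕ × Fin l × ℕ => Y a.1 a.2.1 a.2.2) P

/-- `ξ` is an (ordered) simple random sample without replacement of `r` individuals of generation
`n + 1`: given the family tree up to that generation, every injective `r`-tuple `t` of individuals
of the generation is drawn with the same conditional probability `1 / (N (N - 1) ⋯ (N - r + 1))`,
`N` being the size of the generation. The identity is required on every event `A` of the history on
which all entries of `t` are present (so that `N ≥ r` on `A`). Nothing is required of `ξ` on the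
event `N < r`, on which no such sample exists. -/
structure IsSample [MeasurableSpace Ω] (P : Measure Ω) (Y : ℕ → Fin l → ℕ → Ω → (Fin l → ℕ))
    (i₀ : Fin l) (n r : ℕ) (ξ : Ω → Fin r → Individual l) : Prop where
  measurable : Measurable ξ
  uniform : ∀ t : Fin r → Individual l, Function.Injective t →
    ∀ A : Set Ω, MeasurableSet[history Y n] A → (∀ ω ∈ A, ∀ w, t w ∈ individuals Y i₀ n ω) →
      P (A ∩ {ω | ξ ω = t}) =
        ∫⁻ ω in A, (((size (population Y i₀ (n + 1) ω)).descFactorial r : ℕ) : ℝ≥0∞)⁻¹ ∂P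

/-- The family-size vector reported by the individual `a` of generation `n + 1`: the offspring
vector of its parent. -/
def familySize (Y : ℕ → Fin l → ℕ → Ω → (Fin l → ℕ)) (n : ℕ) (a : Individual l) (ω : Ω) :
    Fin l → ℕ :=
  Y n a.1.1 a.1.2 ω

end BranchingModel

end MultitypeGW

namespace MultitypeGW

/-! Write N_n for the size of generation n. The proof gives an almost sure first-order description
of one generation, then uses that sampling without replacement from a large population is nearly
sampling with replacement. No limit of Z_n / ρ^n is needed, only the direction of Z_n and the ratio
N_{n+1} / N_n.

Growth: every parent has a child, and with probability bounded below at least two, so E[1/N_n]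
decays geometrically (`IsOffspring.lintegral_inv_size_succ_le`) and is summable.

Law of large numbers: given Z_n, the average over generation n of centred scores of the offspring
vectors has second moment at most C/N_n. These bounds have a finite sum in expectation, so the
averages tend to 0 almost surely (`IsOffspring.ae_tendsto_sum_div`). Centred coordinates as scores
give Z_{n+1} = Z_n M + o(N_n); centred indicators of u count the parents with offspring vector u.

Direction: a positive power of M contracts the relative gap between the largest and smallest ratios
Z_{n,i} / b_i. Hence Z_n / N_n → b (`tendsto_direction`) and N_{n+1} / N_n → ρ. A fraction close to
∑ b_j p_j(u) of the parents has offspring vector u, and each leaves |u| children; this is the size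
bias in p_S (`IsOffspring.ae_tendsto_proportion`).

Sampling: given the history, the probability of the reports is a count of injective tuples over a
falling factorial, which tends to the product of the proportions; dominated convergence concludes
(`tendsto_measureReal_mem`). -/

/-- A bounded sequence that contracts along steps of length `m`, up to a vanishing error, tends
to zero. -/
theorem tendsto_zero_of_contraction {x η : ℕ → ℝ} {m : ℕ} {ε : ℝ} (hε : 0 < ε) (hε1 : ε ≤ 1)
    (hx0 : ∀ n, 0 ≤ x n) (hx1 : ∀ n, x n ≤ 1) (hη : Tendsto η atTop (𝓝 0))
    (h : ∀ᶠ n in atTop, x (n + m) ≤ (1 - ε) * x n + η n) : Tendsto x atTop (𝓝 0) := by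
  -- Each step of length m gains a factor 1 - ε. Once η n < ε * θ, the slack θ reproduces itself,
  -- since (1 - ε) * θ + ε * θ = θ.
  have key : ∀ θ : ℝ, 0 < θ → ∀ k : ℕ, ∀ᶠ n in atTop, x n ≤ (1 - ε) ^ k + θ := by
    intro θ hθ k
    induction k with
    | zero => exact Eventually.of_forall fun n => by simpa using (hx1 n).trans (by linarith)
    | succ k ih =>
      have h1 : ∀ᶠ n in atTop, η n < ε * θ := hη.eventually_lt_const (by positivity)
      have h2 : ∀ᶠ n in atTop, x (n + m) ≤ (1 - ε) ^ (k + 1) + θ := by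
        filter_upwards [h, ih, h1] with n a1 a2 a3
        have := mul_le_mul_of_nonneg_left a2 (sub_nonneg.2 hε1)
        rw [pow_succ]
        nlinarith
      rwa [← map_add_atTop_eq_nat m, eventually_map]
  rw [Metric.tendsto_atTop']
  intro θ hθ
  have hpow : Tendsto (fun k : ℕ => (1 - ε) ^ k) atTop (𝓝 0) :=
    tendsto_pow_atTop_nhds_zero_of_lt_one (by linarith) (by linarith)
  obtain ⟨k, hk⟩ := (hpow.eventually_lt_const (half_pos hθ)).exists
  obtain ⟨n0, hn0⟩ := eventually_atTop.1 (key (θ / 2) (half_pos hθ) k)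
  refine ⟨n0, fun n hn => ?_⟩
  rw [Real.dist_eq, sub_zero, abs_of_nonneg (hx0 n)]
  linarith [hn0 n hn.le]

/-! ### Perturbed linear recursions with a positively regular matrix -/

section Deterministic

variable {l : ℕ} {M : Matrix (Fin l) (Fin l) ℝ} {b : Fin l → ℝ} {ρ : ℝ}

theorem vecMul_pow_eq_smul (hb : b ᵥ* M = ρ • b) (m : ℕ) : b ᵥ* (M ^ m) = ρ ^ m • b := by
  induction m with
  | zero => simp
  | succ m ih =>
    rw [pow_succ, ← Matrix.vecMul_vecMul, ih, Matrix.smul_vecMul, hb, smul_smul, pow_succ]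

/-- A nonnegative nonzero left eigenvector of a positively regular matrix is positive. -/
theorem eigenvector_pos (hb0 : ∀ i, 0 ≤ b i) (hb1 : ∑ i, b i = 1) (hb : b ᵥ* M = ρ • b)
    (hρ : 0 < ρ) {m : ℕ} (hM : ∀ i k, 0 < (M ^ m) i k) (k : Fin l) : 0 < b k := by
  obtain ⟨i, -, hi⟩ : ∃ i ∈ Finset.univ, 0 < b i := by
    by_contra! hcon
    linarith [Finset.sum_nonpos hcon]
  have h := congrFun (vecMul_pow_eq_smul hb m) k
  have hpos : 0 < (b ᵥ* (M ^ m)) k := by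
    rw [Matrix.vecMul, dotProduct]
    exact Finset.sum_pos' (fun j _ => mul_nonneg (hb0 j) (hM j k).le)
      ⟨i, Finset.mem_univ _, mul_pos hi (hM i k)⟩
  rw [h, Pi.smul_apply, smul_eq_mul] at hpos
  exact (pos_iff_pos_of_mul_pos hpos).1 (pow_pos hρ m)

/-- The one-step relative errors of a perturbed linear recursion with nondecreasing normalization
accumulate to vanishing `m`-step relative errors. -/
theorem tendsto_error_pow {z : ℕ → Fin l → ℝ} {N : ℕ → ℝ}
    (hN : ∀ n, 0 < N n) (hmono : Monotone N)
    (herr : ∀ k, Tendsto (fun n => (z (n + 1) k - (z n ᵥ* M) k) / N n) atTop (𝓝 0)) (m : ℕ) :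
    ∀ k, Tendsto (fun n => (z (n + m) k - (z n ᵥ* (M ^ m)) k) / N (n + m)) atTop (𝓝 0) := by
  induction m with
  | zero => intro k; simp
  | succ m ih =>
    have shrink : ∀ (f : ℕ → ℝ), Tendsto (fun n => f n / N (n + m)) atTop (𝓝 0) →
        Tendsto (fun n => f n / N (n + (m + 1))) atTop (𝓝 0) := by
      intro f hf
      refine squeeze_zero_norm (fun n => ?_) (by simpa using hf.norm)
      rw [norm_div, Real.norm_of_nonneg (hN _).le, Real.norm_eq_abs, abs_of_pos (hN (n + m))]
      exact div_le_div_of_nonneg_left (abs_nonneg _) (hN _) (hmono (by omega))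
    intro k
    -- The (m + 1)-step error is a fresh one-step error plus the m-step error multiplied by M.
    have h1 := shrink _ ((herr k).comp (tendsto_add_atTop_nat m))
    have h2 := shrink (fun n => ((z (n + m) - z n ᵥ* (M ^ m)) ᵥ* M) k) (by
      have : Tendsto (fun n => ∑ i, (z (n + m) i - (z n ᵥ* (M ^ m)) i) / N (n + m) * M i k)
          atTop (𝓝 (∑ i, 0 * M i k)) :=
        tendsto_finsetSum _ fun i _ => (ih i).mul_const _
      simp only [zero_mul, Finset.sum_const_zero] at this
      refine this.congr fun n => ?_
      simp only [Matrix.vecMul, dotProduct, Pi.sub_apply, Finset.sum_div]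
      exact Finset.sum_congr rfl fun i _ => by ring)
    have h3 := h1.add h2
    rw [add_zero] at h3
    refine h3.congr fun n => ?_
    rw [← add_div, Matrix.sub_vecMul, Matrix.vecMul_vecMul, ← pow_succ, Pi.sub_apply]
    simp only [← add_assoc]
    congr 1
    ring

/-- If `t b` is a sharp upper bound of the nonnegative vector `x` and `a t b` a lower bound, then
the lower bound improves by a fixed proportion of the gap under a positive matrix. -/
theorem lower_bound_improves {A : Matrix (Fin l) (Fin l) ℝ} {x : Fin l → ℝ} {c a t ε : ℝ}
    (hA : ∀ i k, 0 ≤ A i k) (hbA : b ᵥ* A = c • b)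
    (hε : ∀ i k, ε * (c * b k) ≤ b i * A i k) (ha : a ≤ 1) (ht : 0 ≤ t)
    (hlow : ∀ k, a * t * b k ≤ x k) {i : Fin l} (hi : x i = t * b i) (k : Fin l) :
    (a + ε * (1 - a)) * t * (c * b k) ≤ (x ᵥ* A) k := by
  have h1 : (x ᵥ* A) k - a * t * (b ᵥ* A) k = ∑ j, (x j - a * t * b j) * A j k := by
    simp only [Matrix.vecMul, dotProduct, Finset.mul_sum, ← Finset.sum_sub_distrib]
    exact Finset.sum_congr rfl fun j _ => by ring
  -- All terms are nonnegative. The kept one carries the gain: at the index where the upper bound is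
  -- attained, the gap is (1 - a) * t * b i.
  have h2 : (x i - a * t * b i) * A i k ≤ ∑ j, (x j - a * t * b j) * A j k :=
    Finset.single_le_sum (f := fun j => (x j - a * t * b j) * A j k)
      (fun j _ => mul_nonneg (sub_nonneg.2 (hlow j)) (hA j k)) (Finset.mem_univ i)
  have h3 : (b ᵥ* A) k = c * b k := by rw [hbA, Pi.smul_apply, smul_eq_mul]
  have h4 := mul_le_mul_of_nonneg_left (hε i k) (mul_nonneg ht (sub_nonneg.2 ha))
  rw [h3] at h1
  rw [hi] at h2
  nlinarith

/-- Directions of a perturbed linear recursion driven by a positively regular matrix converge to the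
left Perron eigenvector. -/
theorem tendsto_direction (hb0 : ∀ i, 0 ≤ b i) (hb1 : ∑ i, b i = 1)
    (hb : b ᵥ* M = ρ • b) (hρ : 0 < ρ) {m : ℕ} (hM : ∀ i k, 0 < (M ^ m) i k)
    {z : ℕ → Fin l → ℝ} (hz : ∀ n k, 0 ≤ z n k) {N : ℕ → ℝ} (hNz : ∀ n, ∑ k, z n k = N n)
    (hN : ∀ n, 0 < N n) (hmono : Monotone N)
    (herr : ∀ k, Tendsto (fun n => (z (n + 1) k - (z n ᵥ* M) k) / N n) atTop (𝓝 0)) (k : Fin l) :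
    Tendsto (fun n => z n k / N n) atTop (𝓝 (b k)) := by
  have hbpos := eigenvector_pos hb0 hb1 hb hρ hM
  have hne : (Finset.univ : Finset (Fin l)).Nonempty := ⟨k, Finset.mem_univ _⟩
  set c := ρ ^ m with hc
  have hcpos : 0 < c := pow_pos hρ m
  -- largest and smallest ratios
  choose top htop using fun n => Finset.exists_max_image Finset.univ (fun i => z n i / b i) hne
  choose bot hbot using fun n => Finset.exists_min_image Finset.univ (fun i => z n i / b i) hne
  set t : ℕ → ℝ := fun n => z n (top n) / b (top n) with ht
  set s : ℕ → ℝ := fun n => z n (bot n) / b (bot n) with hs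
  have hup : ∀ n i, z n i ≤ t n * b i := fun n i =>
    (div_le_iff₀ (hbpos i)).1 ((htop n).2 i (Finset.mem_univ _))
  have hlow : ∀ n i, s n * b i ≤ z n i := fun n i =>
    (le_div_iff₀ (hbpos i)).1 ((hbot n).2 i (Finset.mem_univ _))
  have htN : ∀ n, N n ≤ t n := fun n => by
    rw [← hNz, ← mul_one (t n), ← hb1, Finset.mul_sum]
    exact Finset.sum_le_sum fun i _ => hup n i
  have hsN : ∀ n, s n ≤ N n := fun n => by
    rw [← hNz, ← mul_one (s n), ← hb1, Finset.mul_sum]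
    exact Finset.sum_le_sum fun i _ => hlow n i
  have htpos : ∀ n, 0 < t n := fun n => (hN n).trans_le (htN n)
  have hs0 : ∀ n, 0 ≤ s n := fun n => div_nonneg (hz _ _) (hbpos _).le
  -- the minorization constant
  obtain ⟨ε, hε, hε1, hεM⟩ : ∃ ε : ℝ, 0 < ε ∧ ε ≤ 1 ∧
      ∀ i k, ε * (c * b k) ≤ b i * (M ^ m) i k := by
    obtain ⟨q, -, hq⟩ := Finset.exists_min_image (Finset.univ : Finset (Fin l × Fin l))
      (fun q => b q.1 * (M ^ m) q.1 q.2 / (c * b q.2)) ⟨(k, k), Finset.mem_univ _⟩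
    have hq0 : 0 < b q.1 * (M ^ m) q.1 q.2 / (c * b q.2) :=
      div_pos (mul_pos (hbpos _) (hM _ _)) (mul_pos hcpos (hbpos _))
    refine ⟨min (b q.1 * (M ^ m) q.1 q.2 / (c * b q.2)) 1, lt_min hq0 one_pos, min_le_right _ _,
      fun i j => ?_⟩
    rw [← le_div_iff₀ (mul_pos hcpos (hbpos j))]
    exact (min_le_left _ _).trans (hq (i, j) (Finset.mem_univ _))
  -- the relative error
  set δ : ℕ → ℝ := fun n => ∑ i, |z (n + m) i - (z n ᵥ* (M ^ m)) i| / N (n + m) / b i with hδ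
  have hδ0 : Tendsto δ atTop (𝓝 0) := by
    have : Tendsto δ atTop (𝓝 (∑ i, |(0 : ℝ)| / b i)) := by
      refine tendsto_finsetSum _ fun i _ => ?_
      refine ((tendsto_error_pow hN hmono herr m i).abs.congr fun n => ?_).div_const _
      rw [abs_div, abs_of_pos (hN _)]
    simpa using this
  have hδle : ∀ n i, |z (n + m) i - (z n ᵥ* (M ^ m)) i| ≤ δ n * t (n + m) * b i := by
    intro n i
    have h1 : |z (n + m) i - (z n ᵥ* (M ^ m)) i| / N (n + m) / b i ≤ δ n :=
      Finset.single_le_sum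
        (f := fun i => |z (n + m) i - (z n ᵥ* (M ^ m)) i| / N (n + m) / b i)
        (fun j _ => div_nonneg (div_nonneg (abs_nonneg _) (hN _).le) (hbpos j).le)
        (Finset.mem_univ i)
    rw [div_le_iff₀ (hbpos i), div_le_iff₀ (hN _)] at h1
    have hδn : 0 ≤ δ n := Finset.sum_nonneg fun j _ =>
      div_nonneg (div_nonneg (abs_nonneg _) (hN _).le) (hbpos j).le
    calc _ ≤ _ := h1
      _ ≤ δ n * b i * t (n + m) :=
        mul_le_mul_of_nonneg_left (htN _) (mul_nonneg hδn (hbpos i).le)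
      _ = _ := by ring
  -- The relative gap contracts because 1 - (a + ε * (1 - a)) = (1 - ε) * (1 - a). The error enters
  -- twice, once at the new maximum and once at the new minimum, hence 2 * δ n.
  have hstep : ∀ n, 1 - s (n + m) / t (n + m) ≤ (1 - ε) * (1 - s n / t n) + 2 * δ n := by
    intro n
    set a := s n / t n with ha
    have ha0 : 0 ≤ a := div_nonneg (hs0 n) (htpos n).le
    have ha1 : a ≤ 1 := (div_le_one (htpos n)).2 ((hsN n).trans (htN n))
    have hat : a * t n = s n := div_mul_cancel₀ _ (htpos n).ne'
    have hbM := vecMul_pow_eq_smul hb m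
    have h1 := lower_bound_improves (x := z n) (fun i k => (hM i k).le) hbM hεM ha1
      (htpos n).le (fun k => by rw [hat]; exact hlow n k)
      (i := top n) (div_mul_cancel₀ _ (hbpos _).ne').symm (bot (n + m))
    have h2 : (z n ᵥ* (M ^ m)) (top (n + m)) ≤ t n * (c * b (top (n + m))) := by
      have h3 := congrFun hbM (top (n + m))
      rw [Pi.smul_apply, smul_eq_mul] at h3
      rw [← h3, Matrix.vecMul, Matrix.vecMul, dotProduct, dotProduct, Finset.mul_sum]
      refine Finset.sum_le_sum fun i _ => ?_
      rw [← mul_assoc]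
      exact mul_le_mul_of_nonneg_right (hup n i) (hM _ _).le
    have h3 := (abs_le.1 (hδle n (top (n + m)))).2
    have h4 := (abs_le.1 (hδle n (bot (n + m)))).1
    have h5 : z (n + m) (top (n + m)) = t (n + m) * b (top (n + m)) :=
      (div_mul_cancel₀ _ (hbpos _).ne').symm
    have h6 : z (n + m) (bot (n + m)) = s (n + m) * b (bot (n + m)) :=
      (div_mul_cancel₀ _ (hbpos _).ne').symm
    rw [h5] at h3
    rw [h6] at h4
    have h7 : t (n + m) * (1 - δ n) ≤ t n * c :=
      le_of_mul_le_mul_right (by linarith) (hbpos (top (n + m)))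
    have h8 : (a + ε * (1 - a)) * (t n * c) - δ n * t (n + m) ≤ s (n + m) :=
      le_of_mul_le_mul_right (by linarith) (hbpos (bot (n + m)))
    have h9 : 0 ≤ a + ε * (1 - a) := add_nonneg ha0 (mul_nonneg hε.le (sub_nonneg.2 ha1))
    have h10 : a + ε * (1 - a) ≤ 1 := by nlinarith
    have hδn : 0 ≤ δ n := Finset.sum_nonneg fun j _ =>
      div_nonneg (div_nonneg (abs_nonneg _) (hN _).le) (hbpos j).le
    have h11 : (a + ε * (1 - a) - 2 * δ n) * t (n + m) ≤ s (n + m) := by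
      have := mul_le_mul_of_nonneg_left h7 h9
      have h12 : (a + ε * (1 - a)) * (δ n * t (n + m)) ≤ 1 * (δ n * t (n + m)) :=
        mul_le_mul_of_nonneg_right h10 (mul_nonneg hδn (htpos _).le)
      linarith
    rw [← le_div_iff₀ (htpos _)] at h11
    linarith
  have hg := tendsto_zero_of_contraction (x := fun n => 1 - s n / t n) hε hε1
    (fun n => sub_nonneg.2 ((div_le_one (htpos n)).2 ((hsN n).trans (htN n))))
    (fun n => sub_le_self _ (div_nonneg (hs0 n) (htpos n).le))
    (by simpa using hδ0.const_mul 2) (Eventually.of_forall hstep)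
  have hratio : Tendsto (fun n => s n / t n) atTop (𝓝 1) := by
    simpa using hg.const_sub 1
  have hratio' : Tendsto (fun n => (s n / t n)⁻¹) atTop (𝓝 1) := by
    simpa using hratio.inv₀ one_ne_zero
  have hpos : ∀ᶠ n in atTop, 0 < s n / t n := hratio.eventually_const_lt one_pos
  -- From s b ≤ z ≤ t b and s ≤ N ≤ t, the quotient z / N lies between (s / t) b and (t / s) b.
  refine tendsto_of_tendsto_of_tendsto_of_le_of_le' (g := fun n => s n / t n * b k)
    (h := fun n => (s n / t n)⁻¹ * b k) (by simpa using hratio.mul_const (b k))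
    (by simpa using hratio'.mul_const (b k)) (Eventually.of_forall fun n => ?_) ?_
  · rw [le_div_iff₀ (hN n)]
    calc s n / t n * b k * N n = s n * b k * (N n / t n) := by ring
      _ ≤ s n * b k * 1 := mul_le_mul_of_nonneg_left ((div_le_one (htpos n)).2 (htN n))
        (mul_nonneg (hs0 n) (hbpos k).le)
      _ ≤ z n k := by rw [mul_one]; exact hlow n k
  · filter_upwards [hpos] with n hn
    have hsp : 0 < s n := by
      have := mul_pos hn (htpos n)
      rwa [div_mul_cancel₀ _ (htpos n).ne'] at this
    rw [div_le_iff₀ (hN n), inv_div]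
    calc z n k ≤ t n * b k * 1 := by rw [mul_one]; exact hup n k
      _ ≤ t n * b k * (N n / s n) := mul_le_mul_of_nonneg_left ((one_le_div hsp).2 (hsN n))
        (mul_nonneg (htpos n).le (hbpos k).le)
      _ = t n / s n * b k * N n := by ring

end Deterministic

/-- Averages of a function of two independent variables may be bounded by conditioning on a countable
one. -/
theorem lintegral_le_of_indepFun {Ω α β : Type*} [MeasurableSpace Ω] [MeasurableSpace α]
    [MeasurableSpace β] [Countable α] [MeasurableSingletonClass α] {P : Measure Ω}
    [IsFiniteMeasure P] {X : Ω → α} {W : Ω → β} (hX : Measurable X) (hW : Measurable W)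
    (hXW : IndepFun X W P) {F : α → β → ℝ≥0∞} (hF : ∀ x, Measurable (F x)) {H : α → ℝ≥0∞}
    (h : ∀ x, ∫⁻ ω, F x (W ω) ∂P ≤ H x) :
    ∫⁻ ω, F (X ω) (W ω) ∂P ≤ ∫⁻ ω, H (X ω) ∂P := by
  have hF' : Measurable (Function.uncurry F) := measurable_from_prod_countable_right hF
  have hmap := (indepFun_iff_map_prod_eq_prod_map_map hX.aemeasurable hW.aemeasurable).1 hXW
  calc ∫⁻ ω, F (X ω) (W ω) ∂P
      = ∫⁻ q, Function.uncurry F q ∂(P.map fun ω => (X ω, W ω)) :=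
        (lintegral_map hF' (hX.prodMk hW)).symm
    _ = ∫⁻ x, ∫⁻ y, F x y ∂(P.map W) ∂(P.map X) := by
        rw [hmap, lintegral_prod _ hF'.aemeasurable]
        rfl
    _ ≤ ∫⁻ x, H x ∂(P.map X) := by
        refine lintegral_mono fun x => ?_
        rw [lintegral_map (hF x) hW]
        exact h x
    _ = ∫⁻ ω, H (X ω) ∂P := lintegral_map (measurable_of_countable H) hX

/-! ### Labels of a generation and the population recursion -/

section Parents

variable {l : ℕ}

/-- Labels of the individuals of a generation with population vector `z`. -/
def parents (z : Fin l → ℕ) : Finset (Fin l × ℕ) :=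
  (Finset.univ.sigma fun j => Finset.range (z j)).map (Equiv.sigmaEquivProd _ _).toEmbedding

theorem mem_parents {z : Fin l → ℕ} {a : Fin l × ℕ} : a ∈ parents z ↔ a.2 < z a.1 := by
  simp [parents, Finset.mem_map_equiv]

theorem sum_parents {A : Type*} [AddCommMonoid A] (z : Fin l → ℕ) (f : Fin l → ℕ → A) :
    ∑ a ∈ parents z, f a.1 a.2 = ∑ j, ∑ i ∈ Finset.range (z j), f j i := by
  rw [parents, Finset.sum_map, Finset.sum_sigma]
  rfl

theorem card_parents (z : Fin l → ℕ) : (parents z).card = size z := by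
  rw [Finset.card_eq_sum_ones, sum_parents z fun _ _ => 1]
  simp [size]

theorem size_sum {ι : Type*} (s : Finset ι) (f : ι → Fin l → ℕ) :
    size (∑ a ∈ s, f a) = ∑ a ∈ s, size (f a) := by
  simp only [size, Finset.sum_apply]
  exact Finset.sum_comm

theorem population_succ {Ω : Type*} (Y : ℕ → Fin l → ℕ → Ω → (Fin l → ℕ)) (i₀ : Fin l) (n : ℕ)
    (ω : Ω) :
    population Y i₀ (n + 1) ω = ∑ a ∈ parents (population Y i₀ n ω), Y n a.1 a.2 ω := by
  rw [sum_parents _ fun j i => Y n j i ω]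
  rfl

theorem size_population_succ {Ω : Type*} (Y : ℕ → Fin l → ℕ → Ω → (Fin l → ℕ)) (i₀ : Fin l) (n : ℕ)
    (ω : Ω) :
    size (population Y i₀ (n + 1) ω) =
      ∑ a ∈ parents (population Y i₀ n ω), size (Y n a.1 a.2 ω) := by
  rw [population_succ, size_sum]

theorem size_population_le {Ω : Type*} {Y : ℕ → Fin l → ℕ → Ω → (Fin l → ℕ)} {i₀ : Fin l} {n : ℕ}
    {ω : Ω} (h : ∀ j i, 1 ≤ size (Y n j i ω)) :
    size (population Y i₀ n ω) ≤ size (population Y i₀ (n + 1) ω) := by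
  rw [size_population_succ, ← card_parents, Finset.card_eq_sum_ones]
  exact Finset.sum_le_sum fun a _ => h _ _

theorem size_population_zero {Ω : Type*} (Y : ℕ → Fin l → ℕ → Ω → (Fin l → ℕ)) (i₀ : Fin l)
    (ω : Ω) : size (population Y i₀ 0 ω) = 1 := by
  simp [population, size]

theorem one_le_size_population {Ω : Type*} {Y : ℕ → Fin l → ℕ → Ω → (Fin l → ℕ)} {i₀ : Fin l}
    {ω : Ω} (h : ∀ n j i, 1 ≤ size (Y n j i ω)) (n : ℕ) : 1 ≤ size (population Y i₀ n ω) := by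
  induction n with
  | zero => rw [size_population_zero]
  | succ n ih => exact ih.trans (size_population_le (h n))

/-- The index set is random, but population vectors form a countable type, so measurability for each
frozen vector suffices. -/
theorem measurable_sum_parents {Ω A : Type*} [MeasurableSpace Ω] [AddCommMonoid A]
    [MeasurableSpace A] [MeasurableAdd₂ A] {Z : Ω → Fin l → ℕ} (hZ : Measurable Z)
    {f : Fin l → ℕ → Ω → A} (hf : ∀ j i, Measurable (f j i)) :
    Measurable fun ω => ∑ a ∈ parents (Z ω), f a.1 a.2 ω := by
  have hfix : ∀ z : Fin l → ℕ, Measurable fun ω => ∑ a ∈ parents z, f a.1 a.2 ω := fun z =>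
    Finset.measurable_fun_sum _ fun a _ => hf a.1 a.2
  have h : Measurable (Function.uncurry fun (z : Fin l → ℕ) ω => ∑ a ∈ parents z, f a.1 a.2 ω) :=
    measurable_from_prod_countable_right hfix
  exact Measurable.comp (f := fun ω => (Z ω, ω)) h (hZ.prodMk measurable_id)

theorem measurable_population {Ω : Type*} [MeasurableSpace Ω]
    {Y : ℕ → Fin l → ℕ → Ω → (Fin l → ℕ)} (i₀ : Fin l) (n : ℕ)
    (hY : ∀ m < n, ∀ j i, Measurable (Y m j i)) : Measurable (population Y i₀ n) := by
  induction n with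
  | zero => exact measurable_const
  | succ n ih =>
    rw [show population Y i₀ (n + 1) = _ from funext (population_succ Y i₀ n)]
    exact measurable_sum_parents (ih fun m hm => hY m (by omega)) (hY n (by omega))

end Parents

/-! ### Independence across generations, growth, and the law of large numbers -/

section Branching

variable {l : ℕ} {Ω : Type*} [MeasurableSpace Ω] {P : Measure Ω}
  {p : Fin l → PMF (Fin l → ℕ)} {Y : ℕ → Fin l → ℕ → Ω → (Fin l → ℕ)}

theorem IsOffspring.measurable_population (hY : IsOffspring P p Y) (i₀ : Fin l) (n : ℕ) :
    Measurable (population Y i₀ n) :=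
  MultitypeGW.measurable_population i₀ n fun m _ => hY.measurable m

theorem IsOffspring.measurable_inv_size (hY : IsOffspring P p Y) (i₀ : Fin l) (n : ℕ) :
    Measurable fun ω => (size (population Y i₀ n ω) : ℝ≥0∞)⁻¹ :=
  (measurable_of_countable fun z : Fin l → ℕ => (size z : ℝ≥0∞)⁻¹).comp
    (hY.measurable_population i₀ n)

/-- The population of generation n depends only on offspring vectors of earlier generations, a
family of indices disjoint from generation n. -/
theorem IsOffspring.indepFun_population (hY : IsOffspring P p Y) (i₀ : Fin l) (n : ℕ) :
    IndepFun (population Y i₀ n) (fun ω j i => Y n j i ω) P := by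
  have hdisj : Disjoint {a : ℕ × Fin l × ℕ | a.1 < n} {a | a.1 = n} :=
    Set.disjoint_left.2 fun a h1 h2 => (ne_of_lt h1) h2
  have h := indep_iSup_of_disjoint (m := fun a : ℕ × Fin l × ℕ =>
    MeasurableSpace.comap (Y a.1 a.2.1 a.2.2) inferInstance)
    (fun a => (hY.measurable _ _ _).comap_le) hY.indep hdisj
  refine indep_of_indep_of_le_left (indep_of_indep_of_le_right h ?_) ?_
  · refine Measurable.comap_le ?_
    refine @measurable_pi_lambda _ _ _ (_) _ _ fun j =>
      @measurable_pi_lambda _ _ _ (_) _ _ fun i => ?_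
    exact Measurable.mono (comap_measurable (Y n j i))
      (le_iSup₂_of_le (n, j, i) rfl le_rfl) le_rfl
  · refine Measurable.comap_le ?_
    refine @MultitypeGW.measurable_population l Ω (_) Y i₀ n fun m hm j i => ?_
    exact Measurable.mono (comap_measurable (Y m j i))
      (le_iSup₂_of_le (m, j, i) hm le_rfl) le_rfl

/-- Stands in for conditioning on the population: an estimate for each frozen vector z may be
averaged over the law of Z_n. -/
theorem IsOffspring.lintegral_population_le [IsProbabilityMeasure P] (hY : IsOffspring P p Y)
    (i₀ : Fin l) (n : ℕ)
    {F : (Fin l → ℕ) → (Fin l → ℕ → Fin l → ℕ) → ℝ≥0∞} (hF : ∀ z, Measurable (F z))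
    {H : (Fin l → ℕ) → ℝ≥0∞} (h : ∀ z, ∫⁻ ω, F z (fun j i => Y n j i ω) ∂P ≤ H z) :
    ∫⁻ ω, F (population Y i₀ n ω) (fun j i => Y n j i ω) ∂P ≤
      ∫⁻ ω, H (population Y i₀ n ω) ∂P :=
  lintegral_le_of_indepFun (hY.measurable_population i₀ n)
    (measurable_pi_lambda _ fun j => measurable_pi_lambda _ fun i => hY.measurable n j i)
    (hY.indepFun_population i₀ n) hF h

theorem IsOffspring.measure_preimage (hY : IsOffspring P p Y) (n : ℕ) (j : Fin l) (i : ℕ)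
    (s : Set (Fin l → ℕ)) : P (Y n j i ⁻¹' s) = (p j).toMeasure s := by
  rw [← hY.law n j i, Measure.map_apply (hY.measurable n j i) (Set.to_countable s).measurableSet]

theorem size_eq_zero_iff {u : Fin l → ℕ} : size u = 0 ↔ u = 0 := by
  simp [size, funext_iff]

theorem size_eq_one_iff {u : Fin l → ℕ} : size u = 1 ↔ ∃ k, u = Pi.single k 1 := by
  refine ⟨fun h => ?_, fun ⟨k, hk⟩ => by simp [hk, size]⟩
  obtain ⟨k, hk⟩ : ∃ k, u k ≠ 0 := by
    by_contra! hcon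
    rw [size_eq_zero_iff.2 (funext hcon)] at h
    exact zero_ne_one h
  refine ⟨k, funext fun i => ?_⟩
  rw [size, ← Finset.add_sum_erase _ _ (Finset.mem_univ k)] at h
  rcases eq_or_ne i k with rfl | hik
  · rw [Pi.single_eq_same]; omega
  · rw [Pi.single_eq_of_ne hik]
    have := Finset.single_le_sum (f := u) (fun _ _ => Nat.zero_le _)
      (Finset.mem_erase.2 ⟨hik, Finset.mem_univ i⟩)
    omega

theorem IsOffspring.ae_one_le_size (hY : IsOffspring P p Y) (hp : ∀ j, p j 0 = 0) :
    ∀ᵐ ω ∂P, ∀ n j i, 1 ≤ size (Y n j i ω) := by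
  rw [ae_all_iff]; intro n
  rw [ae_all_iff]; intro j
  rw [ae_all_iff]; intro i
  have h := hY.measure_preimage n j i {0}
  rw [PMF.toMeasure_apply_singleton _ _ (measurableSet_singleton _), hp] at h
  filter_upwards [compl_mem_ae_iff.2 h] with ω hω
  exact Nat.one_le_iff_ne_zero.2 fun h0 => hω (size_eq_zero_iff.1 h0)

theorem toMeasure_size_eq_one_le (j : Fin l) :
    (p j).toMeasure {u | size u = 1} ≤ ∑ k, p j (Pi.single k 1) := by
  have h : {u : Fin l → ℕ | size u = 1} = ⋃ k, {Pi.single k 1} := by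
    ext u
    simp [size_eq_one_iff, eq_comm]
  rw [h]
  refine (measure_iUnion_fintype_le _ _).trans (Finset.sum_le_sum fun k _ => ?_)
  rw [PMF.toMeasure_apply_singleton _ _ (measurableSet_singleton _)]

/-- Here S ≥ 2N - A, and x ↦ 1/(2N - x) is convex on [0, N]. The right side is its chord, with
values 1/(2N) at 0 and 1/N at N; being affine in A, it has an expectation that is easy to bound. -/
theorem inv_le_of_two_mul_le_add {S A N : ℕ} (hN : 1 ≤ N) (hA : A ≤ N) (h : 2 * N ≤ S + A) :
    (S : ℝ≥0∞)⁻¹ ≤ 2⁻¹ * (N : ℝ≥0∞)⁻¹ + A * (2⁻¹ * (N : ℝ≥0∞)⁻¹ * (N : ℝ≥0∞)⁻¹) := by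
  have hN' : (1 : ℝ) ≤ N := by exact_mod_cast hN
  have hS' : (1 : ℝ) ≤ S := by exact_mod_cast (by omega : 1 ≤ S)
  have hA' : (A : ℝ) ≤ N := by exact_mod_cast hA
  have h' : 2 * (N : ℝ) ≤ S + A := by exact_mod_cast h
  have key : (S : ℝ)⁻¹ ≤ 2⁻¹ * (N : ℝ)⁻¹ + A * (2⁻¹ * (N : ℝ)⁻¹ * (N : ℝ)⁻¹) := by
    have e : 2⁻¹ * (N : ℝ)⁻¹ + A * (2⁻¹ * (N : ℝ)⁻¹ * (N : ℝ)⁻¹) = (N + A) / (2 * N ^ 2) := by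
      field_simp
    rw [e, inv_eq_one_div, div_le_div_iff₀ (by linarith) (by positivity)]
    nlinarith [mul_le_mul_of_nonneg_right h' (by positivity : 0 ≤ (N : ℝ) + A),
      mul_nonneg (Nat.cast_nonneg' A : (0 : ℝ) ≤ A) (sub_nonneg.2 hA')]
  have h2 : (2 : ℝ≥0∞)⁻¹ = ENNReal.ofReal 2⁻¹ := by
    rw [ENNReal.ofReal_inv_of_pos two_pos, ENNReal.ofReal_ofNat]
  have hinv : ∀ m : ℕ, 1 ≤ (m : ℝ) → (m : ℝ≥0∞)⁻¹ = ENNReal.ofReal (m : ℝ)⁻¹ := fun m hm => by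
    rw [ENNReal.ofReal_inv_of_pos (by linarith), ENNReal.ofReal_natCast]
  rw [hinv S hS', hinv N hN', h2, ← ENNReal.ofReal_natCast A, ← ENNReal.ofReal_mul (by positivity),
    ← ENNReal.ofReal_mul (by positivity), ← ENNReal.ofReal_mul (by positivity),
    ← ENNReal.ofReal_add (by positivity) (by positivity)]
  exact ENNReal.ofReal_le_ofReal key

/-- Without childless individuals, the mean reciprocal population decays geometrically. -/
theorem IsOffspring.lintegral_inv_size_succ_le [IsProbabilityMeasure P] (hY : IsOffspring P p Y)
    (hp : ∀ j, p j 0 = 0)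
    {s : ℝ≥0∞} (hs : ∀ j, ∑ k, p j (Pi.single k 1) ≤ s) (i₀ : Fin l) (n : ℕ) :
    ∫⁻ ω, (size (population Y i₀ (n + 1) ω) : ℝ≥0∞)⁻¹ ∂P ≤
      (2⁻¹ + s * 2⁻¹) * ∫⁻ ω, (size (population Y i₀ n ω) : ℝ≥0∞)⁻¹ ∂P := by
  rw [← lintegral_const_mul _ (hY.measurable_inv_size i₀ n)]
  simp_rw [population_succ]
  refine hY.lintegral_population_le i₀ n
    (F := fun z y => (size (∑ a ∈ parents z, y a.1 a.2) : ℝ≥0∞)⁻¹) (fun z => ?_)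
    (H := fun z => (2⁻¹ + s * 2⁻¹) * (size z : ℝ≥0∞)⁻¹) fun z => ?_
  · exact (measurable_of_countable fun z : Fin l → ℕ => (size z : ℝ≥0∞)⁻¹).comp
      (Finset.measurable_fun_sum _ fun a _ => by fun_prop)
  -- In `ℝ≥0∞` the inverse of 0 is `⊤`, so the bound is trivial for an empty generation.
  rcases Nat.eq_zero_or_pos (size z) with h0 | hpos
  · rw [h0, Nat.cast_zero, ENNReal.inv_zero, ENNReal.mul_top]
    · exact le_top
    · simp
  set N := size z with hN
  have hN0 : (N : ℝ≥0∞) ≠ 0 := by exact_mod_cast hpos.ne'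
  have hNt : (N : ℝ≥0∞) ≠ ⊤ := ENNReal.natCast_ne_top N
  have hset : ∀ a : Fin l × ℕ, MeasurableSet (Y n a.1 a.2 ⁻¹' {u | size u = 1}) := fun a =>
    hY.measurable n a.1 a.2 (Set.to_countable _).measurableSet
  calc ∫⁻ ω, (size (∑ a ∈ parents z, Y n a.1 a.2 ω) : ℝ≥0∞)⁻¹ ∂P
      ≤ ∫⁻ ω, (2⁻¹ * (N : ℝ≥0∞)⁻¹ + (∑ a ∈ parents z,
          (Y n a.1 a.2 ⁻¹' {u | size u = 1}).indicator 1 ω) *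
            (2⁻¹ * (N : ℝ≥0∞)⁻¹ * (N : ℝ≥0∞)⁻¹)) ∂P := by
        refine lintegral_mono_ae ?_
        filter_upwards [hY.ae_one_le_size hp] with ω hω
        have e1 : (∑ a ∈ parents z,
            (Y n a.1 a.2 ⁻¹' {u | size u = 1}).indicator (1 : Ω → ℝ≥0∞) ω) =
            ((∑ a ∈ parents z, if size (Y n a.1 a.2 ω) = 1 then 1 else 0 : ℕ) : ℝ≥0∞) := by
          push_cast
          exact Finset.sum_congr rfl fun a _ => by simp [Set.indicator_apply]
        rw [e1]
        refine inv_le_of_two_mul_le_add hpos ?_ ?_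
        · rw [hN, ← card_parents, Finset.card_eq_sum_ones]
          exact Finset.sum_le_sum fun a _ => by split_ifs <;> simp
        -- Each parent contributes at least 2: either one child plus its indicator, or two or more
        -- children.
        · rw [size_sum, ← Finset.sum_add_distrib, hN, ← card_parents, mul_comm, ← smul_eq_mul,
            ← Finset.sum_const]
          refine Finset.sum_le_sum fun a _ => ?_
          have := hω n a.1 a.2
          split_ifs <;> omega
    _ = 2⁻¹ * (N : ℝ≥0∞)⁻¹ + (∑ a ∈ parents z, P (Y n a.1 a.2 ⁻¹' {u | size u = 1})) *
            (2⁻¹ * (N : ℝ≥0∞)⁻¹ * (N : ℝ≥0∞)⁻¹) := by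
        rw [lintegral_add_left measurable_const, lintegral_const, measure_univ, mul_one,
          lintegral_mul_const _ (Finset.measurable_fun_sum _ fun a _ =>
            measurable_one.indicator (hset a)),
          lintegral_finsetSum _ fun a _ => measurable_one.indicator (hset a)]
        simp_rw [lintegral_indicator_one (hset _)]
    _ ≤ 2⁻¹ * (N : ℝ≥0∞)⁻¹ + (N * s) * (2⁻¹ * (N : ℝ≥0∞)⁻¹ * (N : ℝ≥0∞)⁻¹) := by
        gcongr
        rw [hN, ← card_parents, ← nsmul_eq_mul, ← Finset.sum_const]
        refine Finset.sum_le_sum fun a _ => ?_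
        rw [hY.measure_preimage]
        exact (toMeasure_size_eq_one_le _).trans (hs _)
    _ = 2⁻¹ * (N : ℝ≥0∞)⁻¹ + (N * (N : ℝ≥0∞)⁻¹) * s * (2⁻¹ * (N : ℝ≥0∞)⁻¹) := by ring
    _ = (2⁻¹ + s * 2⁻¹) * (N : ℝ≥0∞)⁻¹ := by
        rw [ENNReal.mul_inv_cancel hN0 hNt]; ring

/-- Comparison with a geometric series of ratio (1 + s)/2, where s < 1 is the largest single-child
probability among the finitely many types. -/
theorem IsOffspring.tsum_lintegral_inv_size_ne_top [IsProbabilityMeasure P] (hY : IsOffspring P p Y)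
    (hp : ∀ j, p j 0 = 0)
    (hp1 : ∀ j, ∑ k, p j (Pi.single k 1) < 1) (i₀ : Fin l) :
    ∑' n, ∫⁻ ω, (size (population Y i₀ n ω) : ℝ≥0∞)⁻¹ ∂P ≠ ⊤ := by
  obtain ⟨s, hs, hs1⟩ : ∃ s : ℝ≥0∞, (∀ j, ∑ k, p j (Pi.single k 1) ≤ s) ∧ s < 1 :=
    ⟨Finset.univ.sup fun j => ∑ k, p j (Pi.single k 1),
      fun j => Finset.le_sup (f := fun j => ∑ k, p j (Pi.single k 1)) (Finset.mem_univ j),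
      (Finset.sup_lt_iff (by simp)).2 fun j _ => hp1 j⟩
  set θ : ℝ≥0∞ := 2⁻¹ + s * 2⁻¹ with hθ
  have hθ1 : θ < 1 := by
    rw [hθ, ← ENNReal.inv_two_add_inv_two]
    refine ENNReal.add_lt_add_left (by simp) ?_
    calc s * 2⁻¹ < 1 * 2⁻¹ := ENNReal.mul_lt_mul_left (by simp) (by simp) hs1
      _ = 2⁻¹ := one_mul _
  have hle : ∀ n, ∫⁻ ω, (size (population Y i₀ n ω) : ℝ≥0∞)⁻¹ ∂P ≤ θ ^ n := by
    intro n
    induction n with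
    | zero => simp [size_population_zero]
    | succ n ih =>
      refine (hY.lintegral_inv_size_succ_le hp hs i₀ n).trans ?_
      rw [pow_succ']
      gcongr
  refine ne_top_of_le_ne_top ?_ (ENNReal.tsum_le_tsum hle)
  rw [ENNReal.tsum_geometric, ENNReal.inv_ne_top]
  exact (tsub_pos_of_lt hθ1).ne'

/-- The random series has finite expectation, so it converges almost surely and its terms vanish. -/
theorem ae_tendsto_zero_of_tsum_lintegral {f : ℕ → Ω → ℝ≥0∞} (hf : ∀ n, Measurable (f n))
    (h : ∑' n, ∫⁻ ω, f n ω ∂P ≠ ⊤) : ∀ᵐ ω ∂P, Tendsto (fun n => f n ω) atTop (𝓝 0) := by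
  rw [← lintegral_tsum fun n => (hf n).aemeasurable] at h
  filter_upwards [ae_lt_top (Measurable.tsum hf) h] with ω hω
  exact ENNReal.tendsto_atTop_zero_of_tsum_ne_top hω.ne

theorem IsOffspring.ae_tendsto_inv_size [IsProbabilityMeasure P] (hY : IsOffspring P p Y)
    (hp : ∀ j, p j 0 = 0)
    (hp1 : ∀ j, ∑ k, p j (Pi.single k 1) < 1) (i₀ : Fin l) :
    ∀ᵐ ω ∂P, Tendsto (fun n => (size (population Y i₀ n ω) : ℝ)⁻¹) atTop (𝓝 0) := by
  filter_upwards [ae_tendsto_zero_of_tsum_lintegral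
    (hY.measurable_inv_size i₀)
    (hY.tsum_lintegral_inv_size_ne_top hp hp1 i₀)] with ω hω
  have := (ENNReal.tendsto_toReal ENNReal.zero_ne_top).comp hω
  simpa [Function.comp_def] using this

/-- The second moment of a sum of centred scores of the offspring vectors of a generation. -/
theorem IsOffspring.lintegral_sq_sum_le [IsProbabilityMeasure P] (hY : IsOffspring P p Y)
    {g : Fin l → (Fin l → ℕ) → ℝ}
    (hg : ∀ j, MemLp (g j) 2 (p j).toMeasure) (hg0 : ∀ j, ∫ y, g j y ∂(p j).toMeasure = 0)
    {C : ℝ} (hC : ∀ j, Var[g j; (p j).toMeasure] ≤ C) (n : ℕ) (z : Fin l → ℕ) :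
    ∫⁻ ω, ENNReal.ofReal ((∑ a ∈ parents z, g a.1 (Y n a.1 a.2 ω)) ^ 2) ∂P ≤
      size z * ENNReal.ofReal C := by
  have hgm : ∀ j, Measurable (g j) := fun j => measurable_of_countable _
  set X : Fin l × ℕ → Ω → ℝ := fun a => g a.1 ∘ Y n a.1 a.2 with hX
  have hL : ∀ a, MemLp (X a) 2 P := fun a => by
    have h := hg a.1
    rw [← hY.law n a.1 a.2] at h
    exact h.comp_of_map (hY.measurable n a.1 a.2).aemeasurable
  have hmean : ∀ a, ∫ ω, X a ω ∂P = 0 := fun a => by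
    rw [← hg0 a.1, ← hY.law n a.1 a.2,
      integral_map (hY.measurable n a.1 a.2).aemeasurable (hgm a.1).aestronglyMeasurable]
    rfl
  have hvar : ∀ a, Var[X a; P] ≤ C := fun a => by
    refine le_trans (le_of_eq ?_) (hC a.1)
    rw [← hY.law n a.1 a.2,
      variance_map (hgm a.1).aemeasurable (hY.measurable n a.1 a.2).aemeasurable]
  have hindep : Set.Pairwise ↑(parents z) fun a a' => IndepFun (X a) (X a') P := by
    intro a _ a' _ haa'
    have h := hY.indep.indepFun (i := (n, a.1, a.2)) (j := (n, a'.1, a'.2))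
      (fun h => haa' (congrArg Prod.snd h))
    exact h.comp (hgm _) (hgm _)
  have hS : MemLp (∑ a ∈ parents z, X a) 2 P := memLp_finsetSum' _ fun a _ => hL a
  have hSmean : P[∑ a ∈ parents z, X a] = 0 := by
    simp only [Finset.sum_apply]
    rw [integral_finsetSum _ fun a _ => (hL a).integrable (by norm_num)]
    exact Finset.sum_eq_zero fun a _ => hmean a
  -- The mean is zero, so the second moment is the variance, which is additive by pairwise
  -- independence.
  have h1 := evariance_eq_lintegral_ofReal (∑ a ∈ parents z, X a) P
  rw [hSmean, ← ofReal_variance hS, IndepFun.variance_sum (fun a _ => hL a) hindep] at h1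
  simp only [Finset.sum_apply, sub_zero] at h1
  calc _ = _ := h1.symm
    _ ≤ ENNReal.ofReal (∑ _a ∈ parents z, C) :=
      ENNReal.ofReal_le_ofReal (Finset.sum_le_sum fun a _ => hvar a)
    _ = _ := by
      rw [Finset.sum_const, card_parents, nsmul_eq_mul, ENNReal.ofReal_mul (Nat.cast_nonneg _),
        ENNReal.ofReal_natCast]

theorem IsOffspring.lintegral_sq_sum_div_le [IsProbabilityMeasure P] (hY : IsOffspring P p Y)
    (i₀ : Fin l) {g : Fin l → (Fin l → ℕ) → ℝ}
    (hg : ∀ j, MemLp (g j) 2 (p j).toMeasure) (hg0 : ∀ j, ∫ y, g j y ∂(p j).toMeasure = 0)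
    {C : ℝ} (hC : ∀ j, Var[g j; (p j).toMeasure] ≤ C) (n : ℕ) :
    ∫⁻ ω, ENNReal.ofReal ((∑ a ∈ parents (population Y i₀ n ω), g a.1 (Y n a.1 a.2 ω)) ^ 2) *
        ((size (population Y i₀ n ω) : ℝ≥0∞)⁻¹) ^ 2 ∂P ≤
      ENNReal.ofReal C * ∫⁻ ω, (size (population Y i₀ n ω) : ℝ≥0∞)⁻¹ ∂P := by
  have hgm : ∀ j, Measurable (g j) := fun j => measurable_of_countable _
  rw [← lintegral_const_mul _ (hY.measurable_inv_size i₀ n)]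
  refine hY.lintegral_population_le i₀ n
    (F := fun z y => ENNReal.ofReal ((∑ a ∈ parents z, g a.1 (y a.1 a.2)) ^ 2) *
      ((size z : ℝ≥0∞)⁻¹) ^ 2) (fun z => ?_)
    (H := fun z => ENNReal.ofReal C * (size z : ℝ≥0∞)⁻¹) fun z => ?_
  · have hyz : Measurable fun y : Fin l → ℕ → Fin l → ℕ =>
        ∑ a ∈ parents z, g a.1 (y a.1 a.2) :=
      Finset.measurable_fun_sum _ fun a _ => (hgm a.1).comp (by fun_prop)
    exact ((hyz.pow_const 2).ennreal_ofReal).mul_const _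
  -- For an empty generation the sum is 0, and 0 * ⊤ = 0 makes the left side vanish.
  rcases Nat.eq_zero_or_pos (size z) with h0 | hpos
  · have : parents z = ∅ := by rw [← Finset.card_eq_zero, card_parents, h0]
    simp [this]
  have hN0 : (size z : ℝ≥0∞) ≠ 0 := by exact_mod_cast hpos.ne'
  have hNt : (size z : ℝ≥0∞) ≠ ⊤ := ENNReal.natCast_ne_top _
  rw [lintegral_mul_const' _ _ (by simp [hN0])]
  calc _ ≤ (size z * ENNReal.ofReal C) * ((size z : ℝ≥0∞)⁻¹) ^ 2 := by
        gcongr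
        exact hY.lintegral_sq_sum_le hg hg0 hC n z
    _ = (size z * (size z : ℝ≥0∞)⁻¹) * (ENNReal.ofReal C * (size z : ℝ≥0∞)⁻¹) := by ring
    _ = _ := by rw [ENNReal.mul_inv_cancel hN0 hNt, one_mul]

/-- Strong law of large numbers for centred scores of the offspring vectors of a generation. -/
theorem IsOffspring.ae_tendsto_sum_div [IsProbabilityMeasure P] (hY : IsOffspring P p Y)
    (hp : ∀ j, p j 0 = 0)
    (hp1 : ∀ j, ∑ k, p j (Pi.single k 1) < 1) (i₀ : Fin l) {g : Fin l → (Fin l → ℕ) → ℝ}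
    (hg : ∀ j, MemLp (g j) 2 (p j).toMeasure) (hg0 : ∀ j, ∫ y, g j y ∂(p j).toMeasure = 0) :
    ∀ᵐ ω ∂P, Tendsto (fun n => (∑ a ∈ parents (population Y i₀ n ω), g a.1 (Y n a.1 a.2 ω)) /
      (size (population Y i₀ n ω) : ℝ)) atTop (𝓝 0) := by
  obtain ⟨C, hC⟩ : ∃ C, ∀ j, Var[g j; (p j).toMeasure] ≤ C := by
    obtain ⟨C, hC⟩ := (Set.finite_range fun j => Var[g j; (p j).toMeasure]).bddAbove
    exact ⟨C, fun j => hC ⟨j, rfl⟩⟩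
  have hsum : ∑' n, ∫⁻ ω,
      ENNReal.ofReal ((∑ a ∈ parents (population Y i₀ n ω), g a.1 (Y n a.1 a.2 ω)) ^ 2) *
        ((size (population Y i₀ n ω) : ℝ≥0∞)⁻¹) ^ 2 ∂P ≠ ⊤ := by
    refine ne_top_of_le_ne_top ?_
      (ENNReal.tsum_le_tsum (hY.lintegral_sq_sum_div_le i₀ hg hg0 hC))
    rw [ENNReal.tsum_mul_left]
    exact ENNReal.mul_ne_top ENNReal.ofReal_ne_top (hY.tsum_lintegral_inv_size_ne_top hp hp1 i₀)
  have hFP : ∀ n, Measurable fun ω =>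
      ENNReal.ofReal ((∑ a ∈ parents (population Y i₀ n ω), g a.1 (Y n a.1 a.2 ω)) ^ 2) *
        ((size (population Y i₀ n ω) : ℝ≥0∞)⁻¹) ^ 2 := fun n =>
    ((measurable_sum_parents (hY.measurable_population i₀ n) (f := fun j i ω => g j (Y n j i ω))
      fun j i => (measurable_of_countable (g j)).comp (hY.measurable n j i)).pow_const
        2).ennreal_ofReal.mul ((hY.measurable_inv_size i₀ n).pow_const 2)
  filter_upwards [ae_tendsto_zero_of_tsum_lintegral hFP hsum] with ω hω
  have h1 := ((ENNReal.tendsto_toReal ENNReal.zero_ne_top).comp hω).sqrt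
  rw [ENNReal.toReal_zero, Real.sqrt_zero] at h1
  refine (tendsto_zero_iff_abs_tendsto_zero _).2 (h1.congr fun n => ?_)
  rw [Function.comp_apply, Function.comp_apply, ENNReal.toReal_mul, ENNReal.toReal_pow,
    ENNReal.toReal_inv, ENNReal.toReal_natCast, ENNReal.toReal_ofReal (sq_nonneg _), ← mul_pow,
    Real.sqrt_sq_eq_abs, div_eq_mul_inv]

end Branching

/-! ### Moments of the two scores: coordinates and indicators -/

section Moments

variable {l : ℕ} {p : Fin l → PMF (Fin l → ℕ)}

theorem memLp_coord {j : Fin l}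
    (hp : ∑' u : Fin l → ℕ, p j u * (size u : ℝ≥0∞) ^ 2 ≠ ⊤) (k : Fin l) :
    MemLp (fun u : Fin l → ℕ => (u k : ℝ)) 2 (p j).toMeasure := by
  have hm : Measurable fun u : Fin l → ℕ => (u k : ℝ) := measurable_of_countable _
  rw [memLp_two_iff_integrable_sq hm.aestronglyMeasurable]
  refine ⟨(hm.pow_const 2).aestronglyMeasurable, ?_⟩
  rw [hasFiniteIntegral_iff_ofReal (ae_of_all _ fun u => sq_nonneg _), lintegral_countable']
  refine lt_of_le_of_lt (ENNReal.tsum_le_tsum fun u => ?_) (lt_top_iff_ne_top.2 hp)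
  rw [PMF.toMeasure_apply_singleton _ _ (measurableSet_singleton _), mul_comm,
    ENNReal.ofReal_pow (Nat.cast_nonneg _), ENNReal.ofReal_natCast]
  gcongr
  exact Finset.single_le_sum (f := u) (fun _ _ => Nat.zero_le _) (Finset.mem_univ k)

theorem integral_coord {j : Fin l}
    (hp : ∑' u : Fin l → ℕ, p j u * (size u : ℝ≥0∞) ^ 2 ≠ ⊤) (k : Fin l) :
    ∫ u, (u k : ℝ) ∂(p j).toMeasure = meanMatrix p j k := by
  rw [PMF.integral_eq_tsum _ _ ((memLp_coord hp k).integrable (by norm_num))]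
  rfl

theorem memLp_indicator_singleton (j : Fin l) (u : Fin l → ℕ) :
    MemLp (fun y => if y = u then (1 : ℝ) else 0) 2 (p j).toMeasure :=
  MemLp.of_bound (measurable_of_countable _).aestronglyMeasurable 1
    (ae_of_all _ fun y => by split_ifs <;> simp)

theorem integral_indicator_singleton (j : Fin l) (u : Fin l → ℕ) :
    ∫ y, (if y = u then (1 : ℝ) else 0) ∂(p j).toMeasure = (p j u).toReal := by
  rw [PMF.integral_eq_tsum _ _ ((memLp_indicator_singleton j u).integrable (by norm_num)),
    tsum_eq_single u fun y hy => by simp [hy]]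
  simp

theorem sum_parents_type (z : Fin l → ℕ) (c : Fin l → ℝ) :
    ∑ a ∈ parents z, c a.1 = ∑ j, (z j : ℝ) * c j := by
  rw [sum_parents z fun j _ => c j]
  simp

end Moments

/-! ### Almost sure limits of directions, growth ratios and proportions -/

section Limits

variable {l : ℕ} {Ω : Type*} [MeasurableSpace Ω] {P : Measure Ω} [IsProbabilityMeasure P]
  {p : Fin l → PMF (Fin l → ℕ)} {Y : ℕ → Fin l → ℕ → Ω → (Fin l → ℕ)}

/-- One generation of the process is, to first order, multiplication by the mean matrix. -/
theorem IsOffspring.ae_tendsto_error (hY : IsOffspring P p Y) (hp : ∀ j, p j 0 = 0)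
    (hp1 : ∀ j, ∑ k, p j (Pi.single k 1) < 1)
    (hp2 : ∀ j, ∑' u : Fin l → ℕ, p j u * (size u : ℝ≥0∞) ^ 2 ≠ ⊤) (i₀ : Fin l) :
    ∀ᵐ ω ∂P, ∀ k, Tendsto (fun n => ((population Y i₀ (n + 1) ω k : ℝ) -
      ((fun i => (population Y i₀ n ω i : ℝ)) ᵥ* meanMatrix p) k) /
        (size (population Y i₀ n ω) : ℝ)) atTop (𝓝 0) := by
  rw [ae_all_iff]
  intro k
  filter_upwards [hY.ae_tendsto_sum_div hp hp1 i₀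
    (g := fun j y => (y k : ℝ) - meanMatrix p j k)
    (fun j => (memLp_coord (hp2 j) k).sub (memLp_const _))
    (fun j => by
      rw [integral_sub ((memLp_coord (hp2 j) k).integrable (by norm_num)) (integrable_const _),
        integral_coord (hp2 j)]
      simp)] with ω hω
  refine hω.congr fun n => ?_
  rw [Finset.sum_sub_distrib, sum_parents_type _ fun j => meanMatrix p j k, population_succ,
    Finset.sum_apply, Nat.cast_sum]
  rfl

/-- The number of individuals with offspring vector `u` in a generation, to first order. -/
theorem IsOffspring.ae_tendsto_count_error (hY : IsOffspring P p Y) (hp : ∀ j, p j 0 = 0)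
    (hp1 : ∀ j, ∑ k, p j (Pi.single k 1) < 1) (i₀ : Fin l) (u : Fin l → ℕ) :
    ∀ᵐ ω ∂P, Tendsto (fun n =>
      (({a ∈ parents (population Y i₀ n ω) | Y n a.1 a.2 ω = u}.card : ℝ) -
        ∑ j, (population Y i₀ n ω j : ℝ) * (p j u).toReal) /
          (size (population Y i₀ n ω) : ℝ)) atTop (𝓝 0) := by
  filter_upwards [hY.ae_tendsto_sum_div hp hp1 i₀
    (g := fun j y => (if y = u then (1 : ℝ) else 0) - (p j u).toReal)
    (fun j => (memLp_indicator_singleton j u).sub (memLp_const _))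
    (fun j => by
      rw [integral_sub ((memLp_indicator_singleton j u).integrable (by norm_num))
        (integrable_const _), integral_indicator_singleton]
      simp)] with ω hω
  refine hω.congr fun n => ?_
  rw [Finset.sum_sub_distrib, sum_parents_type _ fun j => (p j u).toReal, Finset.card_filter]
  push_cast
  rfl

/-- The proportion of the individuals of a generation whose parent has offspring vector `u`. -/
theorem IsOffspring.ae_tendsto_proportion (hY : IsOffspring P p Y) (hp : ∀ j, p j 0 = 0)
    (hp1 : ∀ j, ∑ k, p j (Pi.single k 1) < 1)
    (hp2 : ∀ j, ∑' u : Fin l → ℕ, p j u * (size u : ℝ≥0∞) ^ 2 ≠ ⊤)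
    {m : ℕ} (hM : ∀ i k, 0 < (meanMatrix p ^ m) i k) {ρ : ℝ} (hρ : 0 < ρ)
    {b : Fin l → ℝ} (hb0 : ∀ i, 0 ≤ b i) (hb1 : ∑ i, b i = 1) (hb : b ᵥ* meanMatrix p = ρ • b)
    (i₀ : Fin l) (u : Fin l → ℕ) :
    ∀ᵐ ω ∂P, Tendsto (fun n =>
      (({a ∈ parents (population Y i₀ n ω) | Y n a.1 a.2 ω = u}.card * size u : ℕ) : ℝ) /
        (size (population Y i₀ (n + 1) ω) : ℝ)) atTop (𝓝 (sizeBiased p b ρ u)) := by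
  filter_upwards [hY.ae_tendsto_error hp hp1 hp2 i₀, hY.ae_tendsto_count_error hp hp1 i₀ u,
    hY.ae_one_le_size hp] with ω herr hcount hone
  set z : ℕ → Fin l → ℝ := fun n i => (population Y i₀ n ω i : ℝ) with hz
  set N : ℕ → ℝ := fun n => (size (population Y i₀ n ω) : ℝ) with hN
  have hNpos : ∀ n, 0 < N n := fun n => Nat.cast_pos.2 (one_le_size_population hone n)
  have hNz : ∀ n, ∑ k, z n k = N n := fun n => by simp [hz, hN, size]
  have hdir : ∀ k, Tendsto (fun n => z n k / N n) atTop (𝓝 (b k)) :=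
    tendsto_direction hb0 hb1 hb hρ hM (fun n k => Nat.cast_nonneg _) hNz hNpos
      (monotone_nat_of_le_succ fun n => Nat.cast_le.2 (size_population_le (hone n))) herr
  have hlin : ∀ c : Fin l → ℝ,
      Tendsto (fun n => (∑ j, z n j * c j) / N n) atTop (𝓝 (∑ j, b j * c j)) := fun c => by
    refine (tendsto_finsetSum _ fun j _ => (hdir j).mul_const (c j)).congr fun n => ?_
    rw [Finset.sum_div]
    exact Finset.sum_congr rfl fun j _ => by ring
  -- Coordinatewise, Z_{n+1} / N_n → b M = ρ b; summing the coordinates gives ρ because b sums to 1.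
  have hgrow : Tendsto (fun n => N (n + 1) / N n) atTop (𝓝 ρ) := by
    have h1 : ∀ k, Tendsto (fun n => z (n + 1) k / N n) atTop (𝓝 (ρ * b k)) := fun k => by
      have h2 := (herr k).add (hlin fun j => meanMatrix p j k)
      have h3 : ∑ j, b j * meanMatrix p j k = ρ * b k := congrFun hb k
      rw [zero_add, h3] at h2
      refine h2.congr fun n => ?_
      rw [← add_div]
      congr 1
      exact sub_add_cancel _ _
    have h2 := tendsto_finsetSum Finset.univ fun k _ => h1 k
    rw [← Finset.mul_sum, hb1, mul_one] at h2
    refine h2.congr fun n => ?_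
    rw [← Finset.sum_div, hNz]
  have h1 := ((hcount.add (hlin fun j => (p j u).toReal)).div hgrow hρ.ne').mul_const
    (size u : ℝ)
  convert h1 using 2 with n
  · have key : ∀ c s : ℝ, ((c - s) / N n + s / N n) / (N (n + 1) / N n) * (size u : ℝ) =
        c * (size u : ℝ) / N (n + 1) := fun c s => by
      rw [← add_div, sub_add_cancel, div_div_div_cancel_right₀ (hNpos n).ne', div_mul_eq_mul_div]
    rw [Nat.cast_mul]
    exact (key _ _).symm
  · rw [sizeBiased, zero_add]; ring

theorem IsOffspring.ae_tendsto_size (hY : IsOffspring P p Y) (hp : ∀ j, p j 0 = 0)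
    (hp1 : ∀ j, ∑ k, p j (Pi.single k 1) < 1) (i₀ : Fin l) :
    ∀ᵐ ω ∂P, Tendsto (fun n => size (population Y i₀ n ω)) atTop atTop := by
  filter_upwards [hY.ae_tendsto_inv_size hp hp1 i₀, hY.ae_one_le_size hp] with ω h hone
  have h1 : Tendsto (fun n => (size (population Y i₀ n ω) : ℝ)⁻¹) atTop (𝓝[>] 0) :=
    tendsto_nhdsWithin_iff.2 ⟨h, Eventually.of_forall fun n =>
      Set.mem_Ioi.2 (inv_pos.2 (Nat.cast_pos.2 (one_le_size_population hone n)))⟩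
  have h2 := h1.inv_tendsto_nhdsGT_zero
  exact tendsto_natCast_atTop_iff.1 (h2.congr fun n => inv_inv _)

end Limits

/-! ### Counting injective tuples -/

section InjectiveTuples

/-- The injective tuples with `w`-th entry in `S w`. -/
noncomputable def injTuples {α : Type*} {r : ℕ} (S : Fin r → Finset α) : Finset (Fin r → α) :=
  open scoped Classical in {t ∈ Fintype.piFinset S | Function.Injective t}

variable {α : Type*} {r : ℕ}

theorem mem_injTuples {S : Fin r → Finset α} {t : Fin r → α} :
    t ∈ injTuples S ↔ (∀ w, t w ∈ S w) ∧ Function.Injective t := by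
  simp [injTuples]

theorem injTuples_subset {S T : Fin r → Finset α} (h : ∀ w, S w ⊆ T w) :
    injTuples S ⊆ injTuples T := fun t ht => by
  rw [mem_injTuples] at ht ⊢
  exact ⟨fun w => h w (ht.1 w), ht.2⟩

theorem card_injTuples_const (S : Finset α) :
    (injTuples fun _ : Fin r => S).card = S.card.descFactorial r := by
  have h := Fintype.card_embedding_eq (α := Fin r) (β := S)
  rw [Fintype.card_coe, Fintype.card_fin] at h
  rw [← h, ← Finset.card_univ]
  symm
  refine Finset.card_bij (fun e _ w => (e w : α)) (fun e _ => ?_) (fun e _ e' _ hee => ?_)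
    fun t ht => ?_
  · exact mem_injTuples.2 ⟨fun w => (e w).2, Subtype.val_injective.comp e.injective⟩
  · exact DFunLike.ext _ _ fun w => Subtype.ext (congrFun hee w)
  · rw [mem_injTuples] at ht
    exact ⟨⟨fun w => ⟨t w, ht.1 w⟩, fun w w' hw => ht.2 (congrArg Subtype.val hw)⟩,
      Finset.mem_univ _, rfl⟩

theorem card_injTuples_le {S : Fin r → Finset α} {T : Finset α} (h : ∀ w, S w ⊆ T) :
    (injTuples S).card ≤ T.card.descFactorial r := by
  rw [← card_injTuples_const]
  exact Finset.card_le_card (injTuples_subset h)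

/-- Non-injective tuples from subsets are among those from the whole set. -/
theorem prod_card_add_descFactorial_le {S : Fin r → Finset α} {T : Finset α} (h : ∀ w, S w ⊆ T) :
    ∏ w, (S w).card + T.card.descFactorial r ≤ (injTuples S).card + T.card ^ r := by
  classical
  have h1 : (injTuples S).card + {t ∈ Fintype.piFinset S | ¬ Function.Injective t}.card =
      ∏ w, (S w).card := by
    rw [← Fintype.card_piFinset, injTuples,
      ← Finset.card_filter_add_card_filter_not (s := Fintype.piFinset S) Function.Injective]
  have h2 : (injTuples fun _ : Fin r => T).card +
      {t ∈ Fintype.piFinset (fun _ : Fin r => T) | ¬ Function.Injective t}.card = T.card ^ r := by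
    rw [← Fintype.card_piFinset_const, injTuples, ← Finset.card_filter_add_card_filter_not
      (s := Fintype.piFinset fun _ : Fin r => T) Function.Injective]
  have h3 : {t ∈ Fintype.piFinset S | ¬ Function.Injective t}.card ≤
      {t ∈ Fintype.piFinset (fun _ : Fin r => T) | ¬ Function.Injective t}.card :=
    Finset.card_le_card (Finset.filter_subset_filter _ (Fintype.piFinset_subset _ _ h))
  rw [card_injTuples_const] at h2
  omega

theorem card_injTuples_le_prod (S : Fin r → Finset α) :
    (injTuples S).card ≤ ∏ w, (S w).card := by
  classical
  rw [← Fintype.card_piFinset]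
  refine Finset.card_le_card fun t ht => ?_
  rw [Fintype.mem_piFinset]
  exact (mem_injTuples.1 ht).1

/-- Sampling without replacement is close to sampling with replacement. -/
theorem abs_injTuples_div_sub_le {S : Fin r → Finset α} {T : Finset α} (h : ∀ w, S w ⊆ T)
    (hT : 0 < T.card) :
    |((injTuples S).card : ℝ) / (T.card.descFactorial r : ℕ) -
        ∏ w, ((S w).card : ℝ) / (T.card : ℝ)| ≤
      2 * (1 - ((T.card.descFactorial r : ℕ) : ℝ) / (T.card : ℝ) ^ r) := by
  have h1 : (∏ w, ((S w).card : ℝ)) + (T.card.descFactorial r : ℕ) ≤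
      (injTuples S).card + (T.card : ℝ) ^ r := by
    exact_mod_cast prod_card_add_descFactorial_le h
  have h2 : ((injTuples S).card : ℝ) ≤ ∏ w, ((S w).card : ℝ) := by
    exact_mod_cast card_injTuples_le_prod S
  have h3 : ((injTuples S).card : ℝ) ≤ (T.card.descFactorial r : ℕ) := by
    exact_mod_cast card_injTuples_le h
  have h4 : ((T.card.descFactorial r : ℕ) : ℝ) ≤ (T.card : ℝ) ^ r := by
    exact_mod_cast Nat.descFactorial_le_pow _ _
  have hpow : (0 : ℝ) < (T.card : ℝ) ^ r := pow_pos (Nat.cast_pos.2 hT) r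
  set K : ℝ := ((injTuples S).card : ℝ)
  set D : ℝ := ((T.card.descFactorial r : ℕ) : ℝ)
  set Q : ℝ := (T.card : ℝ) ^ r
  have hK : 0 ≤ K := Nat.cast_nonneg _
  have hD : 0 ≤ D := Nat.cast_nonneg _
  have e : ∏ w, ((S w).card : ℝ) / (T.card : ℝ) = (∏ w, ((S w).card : ℝ)) / Q := by
    rw [Finset.prod_div_distrib, Finset.prod_const, Finset.card_univ, Fintype.card_fin]
  have hDQ : D / Q ≤ 1 := (div_le_one hpow).2 h4
  -- The comparison passes through K / Q: changing the denominator costs at most 1 - D / Q, and so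
  -- does restoring the non-injective tuples, of which there are at most Q - D.
  have a1 : |K / D - K / Q| ≤ 1 - D / Q := by
    -- If D = 0, the population has fewer than r members; then K = 0 and both quotients are 0.
    rcases hD.eq_or_lt with h0 | hDpos
    · have : K = 0 := le_antisymm (h0 ▸ h3) hK
      simp [this, ← h0]
    have e1 : K / D - K / Q = K / D * (1 - D / Q) := by
      field_simp
    rw [e1, abs_of_nonneg (mul_nonneg (by positivity) (sub_nonneg.2 hDQ))]
    exact mul_le_of_le_one_left (sub_nonneg.2 hDQ) ((div_le_one hDpos).2 h3)
  have a2 : |K / Q - (∏ w, ((S w).card : ℝ)) / Q| ≤ 1 - D / Q := by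
    rw [← sub_div, abs_div, abs_of_pos hpow, div_le_iff₀ hpow, sub_mul,
      div_mul_cancel₀ _ hpow.ne', abs_of_nonpos (by linarith)]
    linarith
  rw [e]
  calc _ ≤ |K / D - K / Q| + |K / Q - (∏ w, ((S w).card : ℝ)) / Q| := abs_sub_le _ _ _
    _ ≤ _ := by linarith

theorem tendsto_descFactorial_div_pow (r : ℕ) :
    Tendsto (fun N : ℕ => ((N.descFactorial r : ℕ) : ℝ) / (N : ℝ) ^ r) atTop (𝓝 1) := by
  have h : ∀ i : ℕ, Tendsto (fun N : ℕ => ((N - i : ℕ) : ℝ) / (N : ℝ)) atTop (𝓝 1) := by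
    intro i
    have h1 : Tendsto (fun N : ℕ => 1 - (i : ℝ) / (N : ℝ)) atTop (𝓝 (1 - 0)) :=
      (tendsto_const_div_atTop_nhds_zero_nat _).const_sub 1
    rw [sub_zero] at h1
    refine h1.congr' ?_
    filter_upwards [eventually_ge_atTop (i + 1)] with N hN
    have : (N : ℝ) ≠ 0 := Nat.cast_ne_zero.2 (by omega)
    rw [Nat.cast_sub (by omega), sub_div, div_self this]
  have h2 := tendsto_finsetProd (Finset.range r) fun i _ => h i
  rw [Finset.prod_const_one] at h2
  refine h2.congr fun N => ?_
  rw [Finset.prod_div_distrib, Finset.prod_const, Finset.card_range,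
    Nat.descFactorial_eq_prod_range, Nat.cast_prod]

end InjectiveTuples

/-! ### The individuals of a generation and their reports -/

section Children

variable {l : ℕ}

/-- The children of the individuals in `s`, for the offspring vectors `y`. -/
def children (s : Finset (Fin l × ℕ)) (y : Fin l → ℕ → Fin l → ℕ) : Finset (Individual l) :=
  (s.sigma fun a => parents (y a.1 a.2)).map (Equiv.sigmaEquivProd _ _).toEmbedding

theorem mem_children {s : Finset (Fin l × ℕ)} {y : Fin l → ℕ → Fin l → ℕ} {a : Individual l} :
    a ∈ children s y ↔ a.1 ∈ s ∧ a.2.2 < y a.1.1 a.1.2 a.2.1 := by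
  simp [children, Finset.mem_map_equiv, mem_parents]

theorem card_children (s : Finset (Fin l × ℕ)) (y : Fin l → ℕ → Fin l → ℕ) :
    (children s y).card = ∑ a ∈ s, size (y a.1 a.2) := by
  rw [children, Finset.card_map, Finset.card_sigma]
  exact Finset.sum_congr rfl fun a _ => card_parents _

variable {Ω : Type*} (Y : ℕ → Fin l → ℕ → Ω → (Fin l → ℕ)) (i₀ : Fin l) (n : ℕ)

/-- The individuals of generation `n + 1`, as a finite set. -/
def generation (ω : Ω) : Finset (Individual l) :=
  children (parents (population Y i₀ n ω)) fun j i => Y n j i ω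

/-- The individuals of generation `n + 1` that report the family-size vector `u`. -/
def reporters (u : Fin l → ℕ) (ω : Ω) : Finset (Individual l) :=
  {a ∈ generation Y i₀ n ω | familySize Y n a ω = u}

theorem mem_generation {ω : Ω} {a : Individual l} :
    a ∈ generation Y i₀ n ω ↔ a ∈ individuals Y i₀ n ω := by
  rw [generation, mem_children, mem_parents]
  rfl

theorem card_generation (ω : Ω) :
    (generation Y i₀ n ω).card = size (population Y i₀ (n + 1) ω) := by
  rw [generation, card_children, size_population_succ]

/-- The source of the size bias: a parent with offspring vector u is reported once by each of its
|u| children. -/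
theorem card_reporters (u : Fin l → ℕ) (ω : Ω) :
    (reporters Y i₀ n u ω).card =
      {a ∈ parents (population Y i₀ n ω) | Y n a.1 a.2 ω = u}.card * size u := by
  have h : reporters Y i₀ n u ω =
      children {a ∈ parents (population Y i₀ n ω) | Y n a.1 a.2 ω = u} fun j i => Y n j i ω := by
    ext a
    rw [reporters, Finset.mem_filter, generation, mem_children, mem_children, Finset.mem_filter]
    exact and_right_comm
  rw [h, card_children, ← smul_eq_mul, ← Finset.sum_const]
  exact Finset.sum_congr rfl fun a ha => by rw [(Finset.mem_filter.1 ha).2]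

/-- The σ-algebra is left free and only generations up to n are assumed measurable, so that it can
be taken to be `history Y n`. -/
theorem measurableSet_mem_generation [MeasurableSpace Ω]
    (hY : ∀ m ≤ n, ∀ j i, Measurable (Y m j i)) (a : Individual l) :
    MeasurableSet {ω | a ∈ generation Y i₀ n ω} := by
  have h1 : Measurable fun ω => population Y i₀ n ω a.1.1 :=
    (measurable_pi_apply a.1.1).comp (measurable_population i₀ n fun m hm => hY m hm.le)
  have h2 : Measurable fun ω => Y n a.1.1 a.1.2 ω a.2.1 :=
    (measurable_pi_apply a.2.1).comp (hY n le_rfl _ _)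
  have h : {ω | a ∈ generation Y i₀ n ω} =
      {ω | a.1.2 < population Y i₀ n ω a.1.1} ∩ {ω | a.2.2 < Y n a.1.1 a.1.2 ω a.2.1} := by
    ext ω
    exact mem_generation Y i₀ n
  rw [h]
  exact (measurableSet_lt measurable_const h1).inter (measurableSet_lt measurable_const h2)

theorem measurableSet_mem_reporters [MeasurableSpace Ω]
    (hY : ∀ m ≤ n, ∀ j i, Measurable (Y m j i)) (u : Fin l → ℕ) (a : Individual l) :
    MeasurableSet {ω | a ∈ reporters Y i₀ n u ω} := by
  have h : {ω | a ∈ reporters Y i₀ n u ω} =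
      {ω | a ∈ generation Y i₀ n ω} ∩ Y n a.1.1 a.1.2 ⁻¹' {u} := by
    ext ω
    exact Finset.mem_filter
  rw [h]
  exact (measurableSet_mem_generation Y i₀ n hY a).inter
    (hY n le_rfl _ _ (measurableSet_singleton u))

theorem measurableSet_mem_injTuples [MeasurableSpace Ω] {α : Type*} {r : ℕ}
    {S : Ω → Fin r → Finset α} (hS : ∀ w a, MeasurableSet {ω | a ∈ S ω w}) (t : Fin r → α) :
    MeasurableSet {ω | t ∈ injTuples (S ω)} := by
  simp only [mem_injTuples, Set.ofPred_and, Set.ofPred_forall]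
  exact (MeasurableSet.iInter fun w => hS w _).inter (MeasurableSet.const _)

theorem measurable_card_injTuples [MeasurableSpace Ω] {α : Type*} [Countable α] {r : ℕ}
    {S : Ω → Fin r → Finset α} (hS : ∀ w a, MeasurableSet {ω | a ∈ S ω w}) :
    Measurable fun ω => ((injTuples (S ω)).card : ℝ≥0∞) := by
  have h : (fun ω => ((injTuples (S ω)).card : ℝ≥0∞)) =
      fun ω => ∑' t, {ω | t ∈ injTuples (S ω)}.indicator 1 ω := by
    funext ω
    rw [tsum_eq_sum (s := injTuples (S ω)) fun t ht =>
      Set.indicator_of_notMem (s := {ω | t ∈ injTuples (S ω)}) ht _,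
      Finset.card_eq_sum_ones, Nat.cast_sum]
    refine Finset.sum_congr rfl fun t ht => ?_
    rw [Set.indicator_of_mem (s := {ω | t ∈ injTuples (S ω)}) ht, Pi.one_apply, Nat.cast_one]
  rw [h]
  exact Measurable.tsum fun t => measurable_one.indicator (measurableSet_mem_injTuples hS t)

theorem measurable_history {m : ℕ} (hm : m ≤ n) (j : Fin l) (i : ℕ) :
    Measurable[history Y n] (Y m j i) :=
  Measurable.mono (comap_measurable (Y m j i))
    (le_iSup₂_of_le m hm (le_iSup₂_of_le j i le_rfl)) le_rfl

theorem history_le [mΩ : MeasurableSpace Ω] (hY : ∀ m j i, Measurable (Y m j i)) :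
    history Y n ≤ mΩ :=
  iSup₂_le fun m _ => iSup₂_le fun j i => (hY m j i).comap_le

end Children

/-! ### From proportions in the population to probabilities for the sample -/

section Sample

variable {l : ℕ} {Ω : Type*} [MeasurableSpace Ω] {P : Measure Ω}
  {Y : ℕ → Fin l → ℕ → Ω → (Fin l → ℕ)} {i₀ : Fin l} {n r : ℕ} {ξ : Ω → Fin r → Individual l}

/-- The probability that the sample falls in a set of tuples known from the history. -/
theorem IsSample.measure_mem (hξ : IsSample P Y i₀ n r ξ) (hY : ∀ m j i, Measurable (Y m j i))
    {S : Ω → Fin r → Finset (Individual l)}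
    (hS : ∀ w a, MeasurableSet[history Y n] {ω | a ∈ S ω w})
    (hSg : ∀ ω w, S ω w ⊆ generation Y i₀ n ω) :
    P {ω | ξ ω ∈ injTuples (S ω)} =
      ∫⁻ ω, ((injTuples (S ω)).card : ℝ≥0∞) *
        (((size (population Y i₀ (n + 1) ω)).descFactorial r : ℕ) : ℝ≥0∞)⁻¹ ∂P := by
  set D : Ω → ℝ≥0∞ := fun ω =>
    (((size (population Y i₀ (n + 1) ω)).descFactorial r : ℕ) : ℝ≥0∞)⁻¹ with hD
  have hDm : Measurable D :=
    (measurable_of_countable fun z : Fin l → ℕ => (((size z).descFactorial r : ℕ) : ℝ≥0∞)⁻¹).comp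
      (measurable_population i₀ (n + 1) fun m _ => hY m)
  set A : (Fin r → Individual l) → Set Ω := fun t => {ω | t ∈ injTuples (S ω)} with hA
  have hAh : ∀ t, MeasurableSet[history Y n] (A t) := fun t =>
    @measurableSet_mem_injTuples Ω (history Y n) _ r S hS t
  have hAm : ∀ t, MeasurableSet (A t) := fun t => history_le Y n hY _ (hAh t)
  have hξt : ∀ t, MeasurableSet {ω | ξ ω = t} := fun t =>
    hξ.measurable (measurableSet_singleton t)
  have hU : {ω | ξ ω ∈ injTuples (S ω)} = ⋃ t, A t ∩ {ω | ξ ω = t} := by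
    ext ω
    simp [hA]
  rw [hU, measure_iUnion (fun t t' htt => Set.disjoint_left.2 fun ω h h' =>
    htt (h.2.symm.trans h'.2)) fun t => (hAm t).inter (hξt t)]
  have hterm : ∀ t, P (A t ∩ {ω | ξ ω = t}) = ∫⁻ ω, (A t).indicator D ω ∂P := by
    intro t
    -- For injective t the sampling axiom applies on the event `A t`, which belongs to the history;
    -- for other t that event is empty.
    rw [lintegral_indicator (hAm t)]
    by_cases ht : Function.Injective t
    · exact hξ.uniform t ht (A t) (hAh t) fun ω hω w =>
        (mem_generation Y i₀ n).1 (hSg ω w ((mem_injTuples.1 hω).1 w))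
    · have : A t = ∅ := Set.eq_empty_of_forall_notMem fun ω hω => ht (mem_injTuples.1 hω).2
      simp [this]
  simp_rw [hterm]
  rw [← lintegral_tsum fun t => (hDm.indicator (hAm t)).aemeasurable]
  refine lintegral_congr fun ω => ?_
  rw [tsum_eq_sum (s := injTuples (S ω)) fun t ht =>
      Set.indicator_of_notMem (s := A t) ht _, ← nsmul_eq_mul, ← Finset.sum_const]
  exact Finset.sum_congr rfl fun t ht => Set.indicator_of_mem (s := A t) ht _

theorem IsSample.measureReal_mem (hξ : IsSample P Y i₀ n r ξ) (hY : ∀ m j i, Measurable (Y m j i))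
    {S : Ω → Fin r → Finset (Individual l)}
    (hS : ∀ w a, MeasurableSet[history Y n] {ω | a ∈ S ω w})
    (hSg : ∀ ω w, S ω w ⊆ generation Y i₀ n ω) :
    P.real {ω | ξ ω ∈ injTuples (S ω)} =
      ∫ ω, ((injTuples (S ω)).card : ℝ) /
        ((generation Y i₀ n ω).card.descFactorial r : ℕ) ∂P := by
  set D : Ω → ℝ≥0∞ := fun ω =>
    (((size (population Y i₀ (n + 1) ω)).descFactorial r : ℕ) : ℝ≥0∞)⁻¹ with hD
  have hDm : Measurable D :=
    (measurable_of_countable fun z : Fin l → ℕ => (((size z).descFactorial r : ℕ) : ℝ≥0∞)⁻¹).comp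
      (measurable_population i₀ (n + 1) fun m _ => hY m)
  have hcard : Measurable fun ω => ((injTuples (S ω)).card : ℝ≥0∞) :=
    measurable_card_injTuples fun w a => history_le Y n hY _ (hS w a)
  rw [Measure.real, hξ.measure_mem hY hS hSg,
    ← integral_toReal (f := fun ω => ((injTuples (S ω)).card : ℝ≥0∞) * D ω)
      (hcard.mul hDm).aemeasurable]
  · refine integral_congr_ae (ae_of_all _ fun ω => ?_)
    simp [hD, card_generation, div_eq_mul_inv]
  · refine ae_of_all _ fun ω => ?_
    have hle := card_injTuples_le (hSg ω)
    rw [card_generation] at hle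
    rcases Nat.eq_zero_or_pos ((size (population Y i₀ (n + 1) ω)).descFactorial r) with h0 | hpos
    · rw [h0, Nat.le_zero] at hle
      simp [hle]
    · refine ENNReal.mul_lt_top (ENNReal.natCast_lt_top _) (ENNReal.inv_lt_top.2 ?_)
      exact_mod_cast hpos

theorem abs_card_injTuples_div_le_one {α : Type*} {S : Fin r → Finset α} {T : Finset α}
    (h : ∀ w, S w ⊆ T) :
    ‖((injTuples S).card : ℝ) / (T.card.descFactorial r : ℕ)‖ ≤ 1 := by
  rw [Real.norm_of_nonneg (by positivity)]
  exact div_le_one_of_le₀ (Nat.cast_le.2 (card_injTuples_le h)) (Nat.cast_nonneg _)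

/-- If the proportions of the sets `S n w` in the populations `T n` converge almost surely and the
populations grow, then the probabilities that samples from `T n` are in `S n` converge. -/
theorem tendsto_measureReal_mem [IsProbabilityMeasure P] {ξ : ℕ → Ω → Fin r → Individual l}
    (hξ : ∀ n, IsSample P Y i₀ n r (ξ n)) (hY : ∀ m j i, Measurable (Y m j i))
    {S : ℕ → Ω → Fin r → Finset (Individual l)}
    (hS : ∀ n w a, MeasurableSet[history Y n] {ω | a ∈ S n ω w})
    (hSg : ∀ n ω w, S n ω w ⊆ generation Y i₀ n ω) {q : Fin r → ℝ}
    (hq : ∀ᵐ ω ∂P, ∀ w, Tendsto (fun n => ((S n ω w).card : ℝ) /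
      ((generation Y i₀ n ω).card : ℝ)) atTop (𝓝 (q w)))
    (hT : ∀ᵐ ω ∂P, Tendsto (fun n => (generation Y i₀ n ω).card) atTop atTop) :
    Tendsto (fun n => P.real {ω | ξ n ω ∈ injTuples (S n ω)}) atTop (𝓝 (∏ w, q w)) := by
  simp_rw [fun n => (hξ n).measureReal_mem hY (hS n) (hSg n)]
  have hlim := tendsto_integral_of_dominated_convergence (μ := P) (F := fun n ω =>
      ((injTuples (S n ω)).card : ℝ) / ((generation Y i₀ n ω).card.descFactorial r : ℕ))
    (f := fun _ => ∏ w, q w) (fun _ => 1) (fun n => ?_) (integrable_const _)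
    (fun n => ae_of_all _ fun ω => abs_card_injTuples_div_le_one (hSg n ω)) ?_
  · simpa using hlim
  · have h1 : Measurable fun ω => ((injTuples (S n ω)).card : ℝ) := by
      simpa using (measurable_card_injTuples fun w a => history_le Y n hY _ (hS n w a)).ennreal_toReal
    have h2 : Measurable fun ω => (((generation Y i₀ n ω).card.descFactorial r : ℕ) : ℝ) := by
      simp_rw [card_generation]
      exact (measurable_of_countable fun z : Fin l → ℕ => (((size z).descFactorial r : ℕ) : ℝ)).comp
        (measurable_population i₀ (n + 1) fun m _ => hY m)
    exact (h1.div h2).aestronglyMeasurable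
  · filter_upwards [hq, hT] with ω h1 h2
    have h3 : Tendsto (fun n => ∏ w, ((S n ω w).card : ℝ) / ((generation Y i₀ n ω).card : ℝ))
        atTop (𝓝 (∏ w, q w)) := tendsto_finsetProd _ fun w _ => h1 w
    have h4 : Tendsto (fun n => 2 * (1 - (((generation Y i₀ n ω).card.descFactorial r : ℕ) : ℝ) /
        ((generation Y i₀ n ω).card : ℝ) ^ r)) atTop (𝓝 (2 * (1 - 1))) :=
      (((tendsto_descFactorial_div_pow r).comp h2).const_sub 1).const_mul 2
    rw [sub_self, mul_zero] at h4
    have h5 := squeeze_zero_norm' (f := fun n =>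
      ((injTuples (S n ω)).card : ℝ) / ((generation Y i₀ n ω).card.descFactorial r : ℕ) -
        ∏ w, ((S n ω w).card : ℝ) / ((generation Y i₀ n ω).card : ℝ))
      ((h2.eventually_gt_atTop 0).mono fun n hn => abs_injTuples_div_sub_le (hSg n ω) hn) h4
    simpa using h5.add h3

end Sample

end MultitypeGW

theorem theorem4p1 {l : ℕ} (hl : 2 ≤ l)
    -- offspring laws: no childless individuals, and a single child is not certain
    (p : Fin l → PMF (Fin l → ℕ))
    (hp_zero : ∀ j, p j 0 = 0)
    (hp_single : ∀ j, ∑ k, p j (Pi.single k 1) < 1)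
    -- finite second moments
    (hp_sq : ∀ j, ∑' u : Fin l → ℕ, p j u * (MultitypeGW.size u : ℝ≥0∞) ^ 2 ≠ ⊤)
    -- the reproduction matrix is positively regular, with largest eigenvalue `ρ > 1`
    (hreg : ∃ n : ℕ, ∀ i k, 0 < (MultitypeGW.meanMatrix p ^ n) i k)
    (ρ : ℝ)
    (hρ : IsGreatest
      {x : ℝ | Module.End.HasEigenvalue (Matrix.toLin' (MultitypeGW.meanMatrix p)) x} ρ)
    (hρ_one : 1 < ρ)
    -- the normalized nonnegative left eigenvector
    (b : Fin l → ℝ) (hb_nonneg : ∀ i, 0 ≤ b i) (hb_sum : ∑ i, b i = 1)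
    (hb_eig : b ᵥ* MultitypeGW.meanMatrix p = ρ • b)
    -- the branching process
    {Ω : Type*} [MeasurableSpace Ω] (P : Measure Ω) [IsProbabilityMeasure P]
    (Y : ℕ → Fin l → ℕ → Ω → (Fin l → ℕ)) (hY : MultitypeGW.IsOffspring P p Y)
    (i₀ : Fin l)
    -- the sample of `r` individuals; `ξ n` is drawn from generation `n + 1`
    (r : ℕ) (hr : 0 < r) (ξ : ℕ → Ω → Fin r → MultitypeGW.Individual l)
    (hξ : ∀ n, MultitypeGW.IsSample P Y i₀ n r (ξ n))
    (u : Fin r → Fin l → ℕ) :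
    Tendsto (fun n => P.real {ω | ∀ w, MultitypeGW.familySize Y n (ξ n ω w) ω = u w}) atTop
      (𝓝 (∏ w, MultitypeGW.sizeBiased p b ρ (u w))) := by
  open MultitypeGW in
  obtain ⟨m, hM⟩ := hreg
  have hρ0 : 0 < ρ := one_pos.trans hρ_one
  have hYm : ∀ n m' (_ : m' ≤ n) j i, Measurable[history Y n] (Y m' j i) :=
    fun n m' hm j i => measurable_history Y n hm j i
  have hT : ∀ᵐ ω ∂P, Tendsto (fun n => (generation Y i₀ n ω).card) atTop atTop := by
    filter_upwards [hY.ae_tendsto_size hp_zero hp_single i₀] with ω hω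
    simp_rw [card_generation]
    exact hω.comp (tendsto_add_atTop_nat 1)
  have hR := tendsto_measureReal_mem hξ hY.measurable
    (S := fun n ω w => reporters Y i₀ n (u w) ω)
    (fun n w a => @measurableSet_mem_reporters l Ω Y i₀ n (history Y n) (hYm n) (u w) a)
    (fun n ω w => Finset.filter_subset _ _) (q := fun w => sizeBiased p b ρ (u w))
    (by
      rw [ae_all_iff]
      intro w
      simp_rw [card_generation, card_reporters]
      exact hY.ae_tendsto_proportion hp_zero hp_single hp_sq hM hρ0 hb_nonneg hb_sum hb_eig i₀
        (u w)) hT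
  -- Taking the whole generation as target shows that the sample is a genuine tuple of distinct
  -- individuals with probability tending to 1.
  have hG := tendsto_measureReal_mem hξ hY.measurable
    (S := fun n ω _ => generation Y i₀ n ω)
    (fun n w a => @measurableSet_mem_generation l Ω Y i₀ n (history Y n) (hYm n) a)
    (fun n ω w => subset_rfl) (q := fun _ => 1)
    (by
      filter_upwards [hT] with ω hω w
      refine tendsto_const_nhds.congr' ?_
      filter_upwards [hω.eventually_gt_atTop 0] with n hn
      rw [div_self (Nat.cast_ne_zero.2 hn.ne')]) hT
  rw [Finset.prod_const_one] at hG
  have hupper := hR.add (hG.const_sub 1)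
  rw [sub_self, add_zero] at hupper
  -- `familySize` is defined on every label, even absent ones, so the reported event contains the
  -- sampling event of `hR`. The excess lies where ξ n is not a genuine sample, which has vanishing
  -- probability.
  refine tendsto_of_tendsto_of_tendsto_of_le_of_le hR hupper (fun n => ?_) fun n => ?_
  · refine measureReal_mono fun ω hω w => ?_
    exact (Finset.mem_filter.1 ((mem_injTuples.1 hω).1 w)).2
  · have hmeas : MeasurableSet {ω | ξ n ω ∈ injTuples fun _ => generation Y i₀ n ω} := by
      have h : {ω | ξ n ω ∈ injTuples fun _ => generation Y i₀ n ω} =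
          ⋃ t, {ω | t ∈ injTuples fun _ => generation Y i₀ n ω} ∩ {ω | ξ n ω = t} := by
        ext ω
        simp
      rw [h]
      exact MeasurableSet.iUnion fun t => (measurableSet_mem_injTuples (fun _ a =>
        measurableSet_mem_generation Y i₀ n (fun m _ => hY.measurable m) a) t).inter
          ((hξ n).measurable (measurableSet_singleton t))
    dsimp only
    rw [← probReal_compl_eq_one_sub hmeas]
    refine (measureReal_mono fun ω hω => ?_).trans (measureReal_union_le _ _)
    by_cases h : ω ∈ {ω | ξ n ω ∈ injTuples fun _ => generation Y i₀ n ω}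
    · refine Or.inl (mem_injTuples.2 ⟨fun w => ?_, (mem_injTuples.1 h).2⟩)
      exact Finset.mem_filter.2 ⟨(mem_injTuples.1 h).1 w, hω w⟩
    · exact Or.inr h
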